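/- Let $m\ge 0$ be an integer, $0<\mathbf t\le\infty$, and let $u(x,t)$ be an $m\times m$ complex matrix function on the half-strip $0\le x<\infty$, $0\le t<\mathbf t$, which is bounded and self-adjoint ($u=u^*$) there. For $z\in\mathbb C$ put $$G(x,t,z)=\begin{bmatrix}0&I_m\\ u-zI_m&0\end{bmatrix},\qquad F(x,t,z)=\begin{bmatrix}u_x&-2(u+2zI_m)\\ u_{xx}-2(u+2zI_m)(u-zI_m)&-u_x\end{bmatrix}.$$ Assume that $G$ and $F$ are continuously differentiable in $(x,t)$ on the half-strip (with one-sided derivatives on its boundary) and that $u$ satisfies there the matrix KdV equation $$u_t+3(uu_x+u_xu)-u_{xxx}=0 .$$ Let $\Psi$ and $V$ be the $2m\times 2m$ matrix solutions of $$\Psi_x=G\Psi,\quad \Psi(0,t,z)=I_{2m};\qquad V_t=FV,\quad V(x,0,z)=I_{2m}$$ (these exist on the whole half-strip for all $z\in\mathbb C$), and put $$J=\begin{bmatrix}0&I_m\\I_m&0\end{bmatrix},\quad T=\frac1{\sqrt2}\begin{bmatrix}iI_m&I_m\\ iI_m&-I_m\end{bmatrix},\quad H(x,t)=T^*\Psi(x,t,0)^*\begin{bmatrix}I_m&0\\0&0\end{bmatrix}\Psi(x,t,0)T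 .$$ For fixed $t$, let $\widetilde\Psi$ be the fundamental solution of the canonical system $\widetilde\Psi_x(x,t,z)=izJH(x,t)\widetilde\Psi(x,t,z)$, $\widetilde\Psi(0,t,z)=I_{2m}$, on $x\ge0$, and let $\mathcal A_{kj}(l,t,z)$ be the $m\times m$ blocks of $\mathcal A(l,t,z)=\widetilde\Psi(l,t,\overline z)^*$. A function $M(t,z)$, $\operatorname{Im}z>0$, is the Weyl function of this system if for every $z$ with $\operatorname{Im}z>0$ and every choice of $m\times m$ matrices $P_l,Q_l$ $(l>0)$ with $P_l^*P_l+Q_l^*Q_l>0$ and $P_l^*Q_l+Q_l^*P_l\ge0$, the matrices $\mathcal A_{21}P_l+\mathcal A_{22}Q_l$ are invertible for all $l>0$ and $$M(t,z)=\lim_{l\to\infty} i\,(\mathcal A_{11}P_l+\mathcal A_{12}Q_l)(\mathcal A_{21}P_l+\mathcal A_{22}Q_l)^{-1}.$$ Finally let $$R(l,t,z)=\big(\Psi(l,t,0)T\big)^*\big(V(l,t,\overline z)^*\big)^{-1}\Big(\big(\Psi(l,0,0)T\big)^*\Big)^{-1},\qquad R(t,z)=R(0,t,z),$$ and let $r_{kj}(t,z)$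 be the $m\times m$ blocks of $R(t,z)$. Then for every $t\in[0,\mathbf t)$ the Weyl function $M(t,\cdot)$ exists, and for all $t\in[0,\mathbf t)$ and all $z$ with $\operatorname{Im}z>0$ the matrix $-i\,r_{21}(t,z)M(0,z)+r_{22}(t,z)$ is invertible and $$M(t,z)=i\big(-i\,r_{11}(t,z)M(0,z)+r_{12}(t,z)\big)\big(-i\,r_{21}(t,z)M(0,z)+r_{22}(t,z)\big)^{-1}.$$ -/

import Mathlib

/-!
Matrix KdV equation `u_t + 3 (u u_x + u_x u) - u_xxx = 0` on a half-strip, its auxiliary linear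
systems, the associated canonical system and the Weyl function of that system.
-/

namespace MatrixKdV

noncomputable section

open scoped ComplexOrder Topology
open Matrix Filter Set

/-- The `m × m` complex matrices. -/
abbrev Mat (m : ℕ) : Type := Matrix (Fin m) (Fin m) ℂ

/-- The `2m × 2m` complex matrices, seen as `2 × 2` block matrices with `m × m` blocks. -/
abbrev Mat2 (m : ℕ) : Type := Matrix (Fin m ⊕ Fin m) (Fin m ⊕ Fin m) ℂ

/-- The real times `t` with `0 ≤ t < tmax`, where `tmax` is allowed to be `⊤`. -/
def timeSet (tmax : EReal) : Set ℝ := {t | 0 ≤ t ∧ (t : EReal) < tmax}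

/-- The half-strip `0 ≤ x < ∞`, `0 ≤ t < tmax`. -/
def halfStrip (tmax : EReal) : Set (ℝ × ℝ) := Ici 0 ×ˢ timeSet tmax

/-- The entrywise partial derivative in `x` on `0 ≤ x < ∞` (one-sided at `x = 0`). -/
def dx {m : ℕ} (f : ℝ → ℝ → Mat m) (x t : ℝ) : Mat m :=
  Matrix.of fun i j => derivWithin (fun y => f y t i j) (Ici 0) x

/-- The entrywise partial derivative in `t` on `0 ≤ t < tmax` (one-sided at `t = 0`). -/
def dt {m : ℕ} (tmax : EReal) (f : ℝ → ℝ → Mat m) (x t : ℝ) : Mat m :=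
  Matrix.of fun i j => derivWithin (fun s => f x s i j) (timeSet tmax) t

/-- The coefficient `G` of the system `Φ_x = G Φ`. -/
def G {m : ℕ} (u : ℝ → ℝ → Mat m) (x t : ℝ) (z : ℂ) : Mat2 m :=
  fromBlocks 0 1 (u x t - z • (1 : Mat m)) 0

/-- The coefficient `F` of the system `Φ_t = F Φ`. -/
def F {m : ℕ} (u : ℝ → ℝ → Mat m) (x t : ℝ) (z : ℂ) : Mat2 m :=
  fromBlocks
    (dx u x t)
    ((-2 : ℂ) • (u x t + (2 * z) • (1 : Mat m)))
    (dx (dx u) x t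
      - (2 : ℂ) • ((u x t + (2 * z) • (1 : Mat m)) * (u x t - z • (1 : Mat m))))
    (-(dx u x t))

/-- `A`, depending on the parameter `z`, is continuously differentiable on the half-strip
(entry by entry, with one-sided derivatives at the boundary). -/
def IsC1OnStrip {m : ℕ} (tmax : EReal) (A : ℝ → ℝ → ℂ → Mat2 m) : Prop :=
  ∀ (z : ℂ) (i j : Fin m ⊕ Fin m),
    ContDiffOn ℝ 1 (fun p : ℝ × ℝ => A p.1 p.2 z i j) (halfStrip tmax)

/-- `u` satisfies the matrix KdV equation `u_t + 3 (u u_x + u_x u) - u_xxx = 0` on the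
half-strip. -/
def SolvesKdV {m : ℕ} (tmax : EReal) (u : ℝ → ℝ → Mat m) : Prop :=
  ∀ x t : ℝ, 0 ≤ x → t ∈ timeSet tmax →
    dt tmax u x t + (3 : ℂ) • (u x t * dx u x t + dx u x t * u x t) - dx (dx (dx u)) x t = 0

/-- `u` is bounded on the half-strip (all norms on the `m × m` matrices are equivalent, so it is
enough to bound the entries uniformly). -/
def IsBoundedOnStrip {m : ℕ} (tmax : EReal) (u : ℝ → ℝ → Mat m) : Prop :=
  ∃ C : ℝ, ∀ x t : ℝ, 0 ≤ x → t ∈ timeSet tmax → ∀ i j, ‖u x t i j‖ ≤ C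

/-- `u` is self-adjoint on the half-strip. -/
def IsSelfAdjointOnStrip {m : ℕ} (tmax : EReal) (u : ℝ → ℝ → Mat m) : Prop :=
  ∀ x t : ℝ, 0 ≤ x → t ∈ timeSet tmax → (u x t).IsHermitian

/-- `Ψ` is the fundamental solution of the `x`-system: `Ψ_x = G Ψ`, `Ψ(0,t,z) = I`. -/
def IsXFundamental {m : ℕ} (tmax : EReal) (u : ℝ → ℝ → Mat m)
    (Ψ : ℝ → ℝ → ℂ → Mat2 m) : Prop :=
  ∀ t ∈ timeSet tmax, ∀ z : ℂ, Ψ 0 t z = 1 ∧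
    ∀ x : ℝ, 0 ≤ x →
      HasDerivWithinAt (fun y => Ψ y t z) (G u x t z * Ψ x t z) (Ici 0) x

/-- `V` is the fundamental solution of the `t`-system: `V_t = F V`, `V(x,0,z) = I`. -/
def IsTFundamental {m : ℕ} (tmax : EReal) (u : ℝ → ℝ → Mat m)
    (V : ℝ → ℝ → ℂ → Mat2 m) : Prop :=
  ∀ x : ℝ, 0 ≤ x → ∀ z : ℂ, V x 0 z = 1 ∧
    ∀ t ∈ timeSet tmax,
      HasDerivWithinAt (fun s => V x s z) (F u x t z * V x t z) (timeSet tmax) t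

/-- The matrix `J = [0, I; I, 0]`. -/
def J (m : ℕ) : Mat2 m := fromBlocks 0 1 1 0

/-- The unitary matrix `T = (1/√2) [i I, I; i I, -I]`. -/
def T (m : ℕ) : Mat2 m :=
  ((Real.sqrt 2 : ℝ) : ℂ)⁻¹ •
    fromBlocks (Complex.I • (1 : Mat m)) 1 (Complex.I • (1 : Mat m)) (-1)

/-- The Hamiltonian `H(x,t) = T* Ψ(x,t,0)* [I, 0; 0, 0] Ψ(x,t,0) T`. -/
def hamiltonian {m : ℕ} (Ψ : ℝ → ℝ → ℂ → Mat2 m) (x t : ℝ) : Mat2 m :=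
  (T m)ᴴ * (Ψ x t 0)ᴴ * fromBlocks 1 0 0 0 * Ψ x t 0 * T m

/-- `W` is the fundamental solution of the canonical system with Hamiltonian `H` on the
semi-axis: `W_x = i z J H W`, `W(0,z) = I`. -/
def IsCanonicalFundamental {m : ℕ} (H : ℝ → Mat2 m) (W : ℝ → ℂ → Mat2 m) : Prop :=
  ∀ z : ℂ, W 0 z = 1 ∧
    ∀ x : ℝ, 0 ≤ x →
      HasDerivWithinAt (fun y => W y z) ((Complex.I * z) • (J m * H x * W x z)) (Ici 0) x

/-- A nonsingular pair with property-`J`: `P*P + Q*Q > 0` and `P*Q + Q*P ≥ 0`. -/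
def IsJPair {m : ℕ} (P Q : Mat m) : Prop :=
  (Pᴴ * P + Qᴴ * Q).PosDef ∧ (Pᴴ * Q + Qᴴ * P).PosSemidef

/-- The lower row `A₂₁ P + A₂₂ Q` of the linear fractional transformation. -/
def lftDen {m : ℕ} (A : Mat2 m) (P Q : Mat m) : Mat m :=
  A.toBlocks₂₁ * P + A.toBlocks₂₂ * Q

/-- The linear fractional transformation `i (A₁₁ P + A₁₂ Q) (A₂₁ P + A₂₂ Q)⁻¹`. -/
def lft {m : ℕ} (A : Mat2 m) (P Q : Mat m) : Mat m :=
  Complex.I • ((A.toBlocks₁₁ * P + A.toBlocks₁₂ * Q) * (lftDen A P Q)⁻¹)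

/-- `M` is the Weyl function, on the semi-axis, of the canonical system with Hamiltonian `H`.
With `W` the fundamental solution and `A(l,z) = W(l, conj z)*`, for each `z` in the open upper
half-plane and each choice of pairs `P_l`, `Q_l` with property-`J`, the Weyl functions
`M(l,z) = i (A₁₁ P_l + A₁₂ Q_l) (A₂₁ P_l + A₂₂ Q_l)⁻¹` of the intervals `(0,l)` are well defined
and tend to `M(z)` as `l → ∞`. For fixed `z` only the values at `z` of the pairs matter, so the
pairs are families of matrices indexed by `l`. -/
def IsWeylFunction {m : ℕ} (H : ℝ → Mat2 m) (M : ℂ → Mat m) : Prop :=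
  ∃ W : ℝ → ℂ → Mat2 m, IsCanonicalFundamental H W ∧
    ∀ z : ℂ, 0 < z.im → ∀ P Q : ℝ → Mat m, (∀ l : ℝ, 0 < l → IsJPair (P l) (Q l)) →
      (∀ l : ℝ, 0 < l → IsUnit (lftDen (W l (star z))ᴴ (P l) (Q l))) ∧
      Tendsto (fun l : ℝ => lft (W l (star z))ᴴ (P l) (Q l)) atTop (𝓝 (M z))

/-- `R(l,t,z) = (Ψ(l,t,0) T)* (V(l,t,conj z)*)⁻¹ ((Ψ(l,0,0) T)*)⁻¹`. -/
def Rl {m : ℕ} (Ψ V : ℝ → ℝ → ℂ → Mat2 m) (l t : ℝ) (z : ℂ) : Mat2 m :=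
  (Ψ l t 0 * T m)ᴴ * ((V l t (star z))ᴴ)⁻¹ * ((Ψ l 0 0 * T m)ᴴ)⁻¹

/-- `R(t,z) = R(0,t,z)`; its `m × m` blocks are `r₁₁`, `r₁₂`, `r₂₁`, `r₂₂`. -/
def R {m : ℕ} (Ψ V : ℝ → ℝ → ℂ → Mat2 m) (t : ℝ) (z : ℂ) : Mat2 m :=
  Rl Ψ V 0 t z

end

end MatrixKdV

/-! Call the value at a vector of the Hermitian form `sympForm`, that is -i[0, I; -I, 0], its
energy. For Im z > 0 the energy of a solution Ψw of the x-system is nonincreasing in x, with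
derivative -2 Im z times the squared norm of the first component. Since W = T⁻¹Ψ(x,t,0)⁻¹Ψ(x,t,z)T
solves the canonical system, the Weyl functions of (0,l) are iN with N in the Weyl disk at l: every
vector [Nv; v], transported by Ψ(l,t,z)TJ, has nonnegative energy (`qf_weylForm_lftDen`).

The disks are compact and nested. They shrink to one point because a bounded potential puts the
system in the limit point case: a solution with initial energy zero and energy bounded below
vanishes (`eq_zero_of_energy_bddBelow`). Thus the Weyl function exists, and -iM(t,z) is the only
matrix lying in all the disks (`eq_of_mem_weylDisk`).

KdV is the zero curvature condition, so Ψ(x,t,z)V(0,t,z) solves both the x- and the t-system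
(`hasDerivWithinAt_mul_fst`, `hasDerivWithinAt_mul_snd`). On lines x + ct = const with c large, F -
cG makes the energy of this product nondecreasing in t, and F is controlled although u_x and u_xx
need not be bounded: they drop out of the energy identity for F (`F_sympForm`, `energy_le_energy`).
Hence a vector whose energy at time 0 is nonnegative at every x keeps this property at time t, after
the initial vector is moved by V(0,t,z), which is R(t,z) conjugated by TJ (`T_mul_J_mul_R`). So
R(t,z) maps the graph of -iM(0,z) to a graph whose matrix lies in all the disks at time t, and
uniqueness gives the formula. -/

namespace MatrixKdV

open scoped ComplexOrder Topology Matrix.Norms.Operator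
open Matrix Filter Set

/-! ### Intervals of space and of time -/

/-- A half-open interval with left end point `0`, contained in it if it is nonempty. -/
structure IsInitialInterval (s : Set ℝ) : Prop where
  nonneg : ∀ x ∈ s, 0 ≤ x
  Icc_subset : ∀ x ∈ s, Icc 0 x ⊆ s
  exists_gt : ∀ x ∈ s, ∃ y ∈ s, x < y

theorem isInitialInterval_Ici : IsInitialInterval (Ici (0 : ℝ)) where
  nonneg _ hx := hx
  Icc_subset _ _ _ hy := hy.1
  exists_gt x hx := ⟨x + 1, by simp only [mem_Ici] at *; linarith, by linarith⟩

theorem isInitialInterval_timeSet (tmax : EReal) : IsInitialInterval (timeSet tmax) where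
  nonneg _ hx := hx.1
  Icc_subset _ hx _ hy := ⟨hy.1, lt_of_le_of_lt (EReal.coe_le_coe_iff.2 hy.2) hx.2⟩
  exists_gt x hx := by
    obtain ⟨q, hq1, hq2⟩ := EReal.lt_iff_exists_real_btwn.1 hx.2
    have hxq : x < q := EReal.coe_lt_coe_iff.1 hq1
    exact ⟨q, ⟨hx.1.trans hxq.le, hq2⟩, hxq⟩

namespace IsInitialInterval

variable {s : Set ℝ}

theorem zero_mem (hs : IsInitialInterval s) {x : ℝ} (hx : x ∈ s) : (0 : ℝ) ∈ s :=
  hs.Icc_subset x hx ⟨le_rfl, hs.nonneg x hx⟩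

theorem convex (hs : IsInitialInterval s) : Convex ℝ s := by
  refine (ordConnected_def.2 fun x hx y hy z hz => ?_ : OrdConnected s).convex
  exact hs.Icc_subset y hy ⟨(hs.nonneg x hx).trans hz.1, hz.2⟩

theorem uniqueDiffOn (hs : IsInitialInterval s) : UniqueDiffOn ℝ s := by
  rcases s.eq_empty_or_nonempty with rfl | ⟨x, hx⟩
  · exact uniqueDiffOn_empty
  · obtain ⟨y, hy, hxy⟩ := hs.exists_gt x hx
    refine uniqueDiffOn_convex hs.convex ⟨(x + y) / 2, ?_⟩
    refine interior_mono ((Icc_subset_Icc_left (hs.nonneg x hx)).trans (hs.Icc_subset y hy)) ?_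
    rw [interior_Icc]
    constructor <;> linarith

theorem Icc_mem_nhdsWithin (hs : IsInitialInterval s) {x T : ℝ} (hT : x < T) :
    Icc 0 T ∈ 𝓝[s] x := by
  filter_upwards [self_mem_nhdsWithin, mem_nhdsWithin_of_mem_nhds (Iio_mem_nhds hT)] with y hy hyT
  exact ⟨hs.nonneg y hy, le_of_lt hyT⟩

end IsInitialInterval

/-! ### Grönwall estimate and radial retraction -/

section LinearODE

variable {E : Type*} [NormedAddCommGroup E] [NormedSpace ℝ E]

theorem hasDerivWithinAt_Ici_of_Icc_subset {f : ℝ → E} {f' : E} {s : Set ℝ} {x X : ℝ}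
    (h : HasDerivWithinAt f f' s x) (hxX : x < X) (hs : Icc x X ⊆ s) :
    HasDerivWithinAt f f' (Ici x) x :=
  (h.mono hs).mono_of_mem_nhdsWithin (Icc_mem_nhdsGE hxX)

/-- Grönwall's inequality for functions that vanish at `0`. -/
theorem norm_le_of_norm_deriv_le {e e' : ℝ → E} {K ε X : ℝ}
    (he : ∀ x ∈ Icc 0 X, HasDerivWithinAt e (e' x) (Icc 0 X) x) (h0 : e 0 = 0)
    (hb : ∀ x ∈ Icc 0 X, ‖e' x‖ ≤ K * ‖e x‖ + ε) (hε : 0 ≤ ε) (hK : 0 ≤ K) :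
    ∀ x ∈ Icc 0 X, ‖e x‖ ≤ ε * gronwallBound 0 K 1 X := by
  intro x hx
  have h1 := norm_le_gronwallBound_of_norm_deriv_right_le (f := e) (f' := e') (δ := 0) (K := K)
    (ε := ε) (a := 0) (b := X) (fun x hx => (he x hx).continuousWithinAt)
    (fun x hx => hasDerivWithinAt_Ici_of_Icc_subset (he x ⟨hx.1, hx.2.le⟩) hx.2
      (Icc_subset_Icc_left hx.1)) (by simp [h0]) (fun x hx => hb x ⟨hx.1, hx.2.le⟩) x hx
  have h2 : gronwallBound 0 K ε (x - 0) ≤ gronwallBound 0 K ε X :=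
    gronwallBound_mono le_rfl hε hK (by linarith [hx.2])
  have h3 : gronwallBound 0 K ε X = ε * gronwallBound 0 K 1 X := by
    unfold gronwallBound
    split_ifs <;> ring
  linarith

/-- The radial retraction onto the ball of radius `r`. -/
noncomputable def radialRetraction (r : ℝ) (x : E) : E := (r / max r ‖x‖) • x

theorem radialRetraction_of_norm_le {r : ℝ} (hr : 0 < r) {x : E} (hx : ‖x‖ ≤ r) :
    radialRetraction r x = x := by
  rw [radialRetraction, max_eq_left hx, div_self hr.ne', one_smul]

theorem norm_radialRetraction_le_norm {r : ℝ} (hr : 0 < r) (x : E) :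
    ‖radialRetraction r x‖ ≤ ‖x‖ := by
  rw [radialRetraction, norm_smul, Real.norm_of_nonneg (by positivity)]
  have : r / max r ‖x‖ ≤ 1 := div_le_one_of_le₀ (le_max_left _ _) (by positivity)
  nlinarith [norm_nonneg x]

theorem norm_radialRetraction_le {r : ℝ} (hr : 0 < r) (x : E) : ‖radialRetraction r x‖ ≤ r := by
  rw [radialRetraction, norm_smul, Real.norm_of_nonneg (by positivity), div_mul_eq_mul_div]
  exact div_le_of_le_mul₀ (by positivity) hr.le (by gcongr; exact le_max_right _ _)

theorem norm_radialRetraction_sub_le {r : ℝ} (hr : 0 < r) (x y : E) :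
    ‖radialRetraction r x - radialRetraction r y‖ ≤ 2 * ‖x - y‖ := by
  set a := max r ‖x‖
  set b := max r ‖y‖
  have ha : 0 < a := lt_max_of_lt_left hr
  have hb : 0 < b := lt_max_of_lt_left hr
  have hra : r ≤ a := le_max_left _ _
  have hyb : ‖y‖ ≤ b := le_max_right _ _
  have hab : |b - a| ≤ ‖x - y‖ := by
    rw [abs_sub_comm]
    exact (abs_max_sub_max_le_max _ _ _ _).trans (by simpa using abs_norm_sub_norm_le x y)
  have h : radialRetraction r x - radialRetraction r y =
      (r / a) • (x - y) + (r / a * (b - a) / b) • y := by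
    simp only [radialRetraction]
    rw [smul_sub, sub_add, ← sub_smul]
    congr 2
    change r / b = _
    field_simp
    ring
  rw [h]
  have h1 : r / a ≤ 1 := (div_le_one ha).2 hra
  have h2 : ‖(r / a) • (x - y)‖ ≤ ‖x - y‖ := by
    rw [norm_smul, Real.norm_of_nonneg (by positivity)]
    nlinarith [norm_nonneg (x - y)]
  have h3 : ‖(r / a * (b - a) / b) • y‖ ≤ ‖x - y‖ := by
    rw [norm_smul, Real.norm_eq_abs, abs_div, abs_mul, abs_of_nonneg (by positivity : 0 ≤ r / a),
      abs_of_pos hb, div_mul_eq_mul_div]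
    refine div_le_of_le_mul₀ hb.le (norm_nonneg _) ?_
    have : r / a * |b - a| ≤ ‖x - y‖ := by
      nlinarith [abs_nonneg (b - a), norm_nonneg (x - y)]
    exact mul_le_mul this hyb (norm_nonneg _) (norm_nonneg _)
  linarith [norm_add_le ((r / a) • (x - y)) ((r / a * (b - a) / b) • y)]

end LinearODE

/-! ### Linear differential equations in a Banach algebra -/

section

variable {𝔸 : Type*} [NormedRing 𝔸] [NormedAlgebra ℝ 𝔸]

theorem linearODE_eqOn_Icc {A Y Z : ℝ → 𝔸} {T : ℝ} (hA : ContinuousOn A (Icc 0 T))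
    (hY : ∀ x ∈ Icc 0 T, HasDerivWithinAt Y (A x * Y x) (Icc 0 T) x)
    (hZ : ∀ x ∈ Icc 0 T, HasDerivWithinAt Z (A x * Z x) (Icc 0 T) x) (h0 : Y 0 = Z 0) :
    ∀ x ∈ Icc 0 T, Y x = Z x := by
  obtain ⟨K, hK⟩ := isCompact_Icc.exists_bound_of_continuousOn hA
  intro x hx
  have h := norm_le_of_norm_deriv_le (e := fun x => Y x - Z x) (K := max K 0) (ε := 0)
    (fun x hx => (hY x hx).sub (hZ x hx)) (by simp [h0])
    (fun x hx => by
      rw [← mul_sub, add_zero]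
      refine (norm_mul_le _ _).trans ?_
      gcongr
      exact (hK x hx).trans (le_max_left _ _)) le_rfl (le_max_right _ _) x hx
  simpa [sub_eq_zero] using h

theorem linearODE_eqOn {A Y Z : ℝ → 𝔸} {s : Set ℝ} (hs : IsInitialInterval s)
    (hA : ContinuousOn A s)
    (hY : ∀ x ∈ s, HasDerivWithinAt Y (A x * Y x) s x)
    (hZ : ∀ x ∈ s, HasDerivWithinAt Z (A x * Z x) s x) (h0 : Y 0 = Z 0) :
    ∀ x ∈ s, Y x = Z x := fun x hx =>
  linearODE_eqOn_Icc (hA.mono (hs.Icc_subset x hx))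
    (fun y hy => (hY y (hs.Icc_subset x hx hy)).mono (hs.Icc_subset x hx))
    (fun y hy => (hZ y (hs.Icc_subset x hx hy)).mono (hs.Icc_subset x hx)) h0 x
    ⟨hs.nonneg x hx, le_rfl⟩

variable [CompleteSpace 𝔸]

/-- The field Y ↦ A(x)Y is unbounded, so Picard–Lindelöf alone gives only short intervals. Composed
with the radial retraction the field is bounded and still Lipschitz, hence solvable on all of [0,
T]; the a priori Grönwall bound then shows that the retraction never acts. -/
theorem exists_linearODE_Icc {A : ℝ → 𝔸} {T : ℝ} (hT : 0 ≤ T) (hA : ContinuousOn A (Icc 0 T))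
    (Y₀ : 𝔸) :
    ∃ Y : ℝ → 𝔸, Y 0 = Y₀ ∧ ∀ x ∈ Icc 0 T, HasDerivWithinAt Y (A x * Y x) (Icc 0 T) x := by
  obtain ⟨K₀, hK₀⟩ := isCompact_Icc.exists_bound_of_continuousOn hA
  obtain ⟨K, hK0, hK⟩ : ∃ K : ℝ, 0 ≤ K ∧ ∀ x ∈ Icc 0 T, ‖A x‖ ≤ K :=
    ⟨max K₀ 0, le_max_right _ _, fun x hx => (hK₀ x hx).trans (le_max_left _ _)⟩
  -- The radius exceeds the largest norm that Grönwall allows on [0, T]; the added 1 makes it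
  -- positive even for `Y₀ = 0`.
  set r : ℝ := gronwallBound ‖Y₀‖ K 0 T + 1
  have hg : 0 ≤ gronwallBound ‖Y₀‖ K 0 T := by rw [gronwallBound_ε0]; positivity
  have hr : 0 < r := by positivity
  lift K to NNReal using hK0
  have hpl : IsPicardLindelof (fun x Y => A x * radialRetraction r Y)
      (⟨0, le_rfl, hT⟩ : Icc 0 T) Y₀ (K * r.toNNReal * T.toNNReal) 0 (K * r.toNNReal) (K * 2) :=
    { lipschitzOnWith := fun x hx => by
        refine LipschitzOnWith.of_dist_le_mul fun Y _ Z _ => ?_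
        rw [dist_eq_norm, dist_eq_norm, ← mul_sub]
        refine (norm_mul_le _ _).trans ?_
        have := norm_radialRetraction_sub_le hr Y Z
        push_cast
        rw [mul_assoc]
        exact mul_le_mul (hK x hx) this (norm_nonneg _) K.2
      continuousOn := fun Y _ => hA.mul continuousOn_const
      norm_le := fun x hx Y _ => by
        refine (norm_mul_le _ _).trans ?_
        push_cast
        rw [Real.coe_toNNReal _ hr.le]
        exact mul_le_mul (hK x hx) (norm_radialRetraction_le hr Y) (norm_nonneg _) K.2
      mul_max_le := by simp [hT] }
  obtain ⟨Y, hY0, hY⟩ := hpl.exists_eq_forall_mem_Icc_hasDerivWithinAt₀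
  refine ⟨Y, hY0, fun x hx => ?_⟩
  have hb := norm_le_gronwallBound_of_norm_deriv_right_le (f := Y) (δ := ‖Y₀‖) (K := K) (ε := 0)
    (fun x hx => (hY x hx).continuousWithinAt)
    (fun x hx => hasDerivWithinAt_Ici_of_Icc_subset (hY x ⟨hx.1, hx.2.le⟩) hx.2
      (Icc_subset_Icc_left hx.1)) (by simpa using congrArg norm hY0 |>.le)
    (fun x hx => by
      rw [add_zero]
      exact (norm_mul_le _ _).trans (mul_le_mul (hK x ⟨hx.1, hx.2.le⟩)
        (norm_radialRetraction_le_norm hr _) (norm_nonneg _) K.2)) x hx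
  have hm := gronwallBound_mono (norm_nonneg Y₀) le_rfl K.coe_nonneg
    (show x - 0 ≤ T by linarith [hx.2])
  have := hY x hx
  have hYr : ‖Y x‖ ≤ r := by
    change _ ≤ gronwallBound ‖Y₀‖ K 0 T + 1
    linarith
  rwa [radialRetraction_of_norm_le hr hYr] at this

/-- A linear differential equation with continuous coefficient has a solution on the whole
interval. -/
theorem exists_linearODE {A : ℝ → 𝔸} {s : Set ℝ} (hs : IsInitialInterval s)
    (hA : ContinuousOn A s) (Y₀ : 𝔸) :
    ∃ Y : ℝ → 𝔸, Y 0 = Y₀ ∧ ∀ x ∈ s, HasDerivWithinAt Y (A x * Y x) s x := by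
  have hex : ∀ T : ℝ, ∃ Y : ℝ → 𝔸, Y 0 = Y₀ ∧
      (T ∈ s → ∀ x ∈ Icc 0 T, HasDerivWithinAt Y (A x * Y x) (Icc 0 T) x) := fun T => by
    by_cases hT : T ∈ s
    · obtain ⟨Y, h0, h⟩ :=
        exists_linearODE_Icc (hs.nonneg T hT) (hA.mono (hs.Icc_subset T hT)) Y₀
      exact ⟨Y, h0, fun _ => h⟩
    · exact ⟨fun _ => Y₀, rfl, fun h => absurd h hT⟩
  choose Y hY0 hY using hex
  -- The solutions on the intervals [0, T] agree by uniqueness, so the diagonal glues them together.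
  refine ⟨fun x => Y x x, hY0 0, fun x hx => ?_⟩
  obtain ⟨T, hTs, hT⟩ := hs.exists_gt x hx
  have hEq : ∀ y ∈ Icc 0 T, Y y y = Y T y := fun y hy => by
    have hys := hs.Icc_subset T hTs hy
    refine linearODE_eqOn_Icc (hA.mono (hs.Icc_subset y hys)) (hY y hys)
      (fun z hz => ?_) ((hY0 y).trans (hY0 T).symm) y ⟨hy.1, le_rfl⟩
    exact (hY T hTs z ⟨hz.1, hz.2.trans hy.2⟩).mono (Icc_subset_Icc_right hy.2)
  have hxT : x ∈ Icc 0 T := ⟨hs.nonneg x hx, hT.le⟩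
  refine HasDerivWithinAt.mono_of_mem_nhdsWithin ?_ (hs.Icc_mem_nhdsWithin hT)
  simp only [hEq x hxT]
  exact (hY T hTs x hxT).congr hEq (hEq x hxT)

end

/-! ### Entrywise differentiation and continuity of matrices -/

section MatrixDeriv

theorem hasDerivWithinAt_matrix_iff {p q : Type*} [Fintype p] [Fintype q] [DecidableEq p]
    [DecidableEq q] {A : ℝ → Matrix p q ℂ} {A' : Matrix p q ℂ} {s : Set ℝ}
    {x : ℝ} : HasDerivWithinAt A A' s x ↔
      ∀ i j, HasDerivWithinAt (fun y => A y i j) (A' i j) s x := by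
  constructor
  · intro h i j
    have h1 := hasDerivWithinAt_pi.1 (show HasDerivWithinAt (F := p → q → ℂ) A A' s x from h) i
    exact hasDerivWithinAt_pi.1 h1 j
  · intro h
    exact (show HasDerivWithinAt (F := p → q → ℂ) A A' s x from
      hasDerivWithinAt_pi.2 fun i => hasDerivWithinAt_pi.2 fun j => h i j)

theorem continuousOn_matrix_iff {p q X : Type*} [TopologicalSpace X] {A : X → Matrix p q ℂ}
    {s : Set X} : ContinuousOn A s ↔ ∀ i j, ContinuousOn (fun y => A y i j) s := by
  constructor
  · intro h i j
    exact (continuous_id.matrix_elem i j).comp_continuousOn h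
  · intro h
    exact continuousOn_pi.2 fun i => continuousOn_pi.2 fun j => h i j

theorem hasDerivWithinAt_conjTranspose {p : Type*} [Fintype p] [DecidableEq p]
    {A : ℝ → Matrix p p ℂ} {A' : Matrix p p ℂ} {s : Set ℝ}
    {x : ℝ} (h : HasDerivWithinAt A A' s x) :
    HasDerivWithinAt (fun y => (A y)ᴴ) A'ᴴ s x :=
  hasDerivWithinAt_matrix_iff.2 fun i j => (hasDerivWithinAt_matrix_iff.1 h j i).star

theorem hasDerivWithinAt_fromBlocks {m : ℕ} {A B C D : ℝ → Mat m} {A' B' C' D' : Mat m}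
    {s : Set ℝ} {x : ℝ} (hA : HasDerivWithinAt A A' s x) (hB : HasDerivWithinAt B B' s x)
    (hC : HasDerivWithinAt C C' s x) (hD : HasDerivWithinAt D D' s x) :
    HasDerivWithinAt (fun y => Matrix.fromBlocks (A y) (B y) (C y) (D y))
      (Matrix.fromBlocks A' B' C' D') s x := by
  refine hasDerivWithinAt_matrix_iff.2 ?_
  rintro (i | i) (j | j)
  · exact hasDerivWithinAt_matrix_iff.1 hA i j
  · exact hasDerivWithinAt_matrix_iff.1 hB i j
  · exact hasDerivWithinAt_matrix_iff.1 hC i j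
  · exact hasDerivWithinAt_matrix_iff.1 hD i j

end MatrixDeriv

/-! ### Regularity on the half-strip and zero curvature -/

section Strip

variable {tmax : EReal}

theorem uniqueDiffOn_halfStrip (tmax : EReal) : UniqueDiffOn ℝ (halfStrip tmax) :=
  isInitialInterval_Ici.uniqueDiffOn.prod (isInitialInterval_timeSet tmax).uniqueDiffOn

theorem hasDerivWithinAt_fst {h : ℝ × ℝ → ℂ} (hh : ContDiffOn ℝ 1 h (halfStrip tmax))
    {x t : ℝ} (hx : 0 ≤ x) (ht : t ∈ timeSet tmax) :
    HasDerivWithinAt (fun y => h (y, t)) (derivWithin (fun y => h (y, t)) (Ici 0) x) (Ici 0) x := by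
  have h1 : DifferentiableWithinAt ℝ h (halfStrip tmax) (x, t) :=
    hh.differentiableOn one_ne_zero _ ⟨hx, ht⟩
  have h2 : DifferentiableWithinAt ℝ (fun y : ℝ => (y, t)) (Ici 0) x :=
    differentiableWithinAt_id.prodMk (differentiableWithinAt_const _)
  exact (h1.comp x h2 fun y hy => mk_mem_prod hy ht).hasDerivWithinAt

theorem hasDerivWithinAt_snd {h : ℝ × ℝ → ℂ} (hh : ContDiffOn ℝ 1 h (halfStrip tmax))
    {x t : ℝ} (hx : 0 ≤ x) (ht : t ∈ timeSet tmax) :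
    HasDerivWithinAt (fun s => h (x, s)) (fderivWithin ℝ h (halfStrip tmax) (x, t) (0, 1))
      (timeSet tmax) t := by
  have h1 : HasFDerivWithinAt h (fderivWithin ℝ h (halfStrip tmax) (x, t))
      (halfStrip tmax) (x, t) :=
    (hh.differentiableOn one_ne_zero (x, t) (mk_mem_prod (mem_Ici.2 hx) ht)).hasFDerivWithinAt
  have h2 : HasDerivWithinAt (fun s : ℝ => (x, s)) (0, 1) (timeSet tmax) t :=
    (hasDerivWithinAt_const _ _ _).prodMk (hasDerivWithinAt_id _ _)
  exact h1.comp_hasDerivWithinAt t h2 fun s hs => mk_mem_prod (mem_Ici.2 hx) hs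

theorem continuousOn_derivWithin_snd {h : ℝ × ℝ → ℂ} (hh : ContDiffOn ℝ 1 h (halfStrip tmax)) :
    ContinuousOn (fun p : ℝ × ℝ => derivWithin (fun s => h (p.1, s)) (timeSet tmax) p.2)
      (halfStrip tmax) := by
  have h1 := hh.continuousOn_fderivWithin (uniqueDiffOn_halfStrip tmax) le_rfl
  refine (h1.clm_apply (continuousOn_const (c := ((0 : ℝ), (1 : ℝ))))).congr ?_
  rintro ⟨x, t⟩ ⟨hx, ht⟩
  exact (hasDerivWithinAt_snd hh hx ht).derivWithin
    ((isInitialInterval_timeSet tmax).uniqueDiffOn t ht)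

variable {m : ℕ} {v : ℝ → ℝ → Mat m}

/-- Continuous differentiability, entry by entry, of an `m × m` matrix function on the strip. -/
def ContDiffOnStrip (tmax : EReal) (v : ℝ → ℝ → Mat m) : Prop :=
  ∀ i j, ContDiffOn ℝ 1 (fun p : ℝ × ℝ => v p.1 p.2 i j) (halfStrip tmax)

namespace ContDiffOnStrip

theorem hasDerivWithinAt_dx (h : ContDiffOnStrip tmax v) {x t : ℝ} (hx : 0 ≤ x)
    (ht : t ∈ timeSet tmax) : HasDerivWithinAt (fun y => v y t) (dx v x t) (Ici 0) x :=
  hasDerivWithinAt_matrix_iff.2 fun i j => hasDerivWithinAt_fst (h i j) hx ht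

theorem hasDerivWithinAt_dt (h : ContDiffOnStrip tmax v) {x t : ℝ} (hx : 0 ≤ x)
    (ht : t ∈ timeSet tmax) :
    HasDerivWithinAt (fun s => v x s) (dt tmax v x t) (timeSet tmax) t :=
  hasDerivWithinAt_matrix_iff.2 fun i j =>
    (hasDerivWithinAt_snd (h i j) hx ht).differentiableWithinAt.hasDerivWithinAt

theorem continuousOn (h : ContDiffOnStrip tmax v) :
    ContinuousOn (fun p : ℝ × ℝ => v p.1 p.2) (halfStrip tmax) :=
  continuousOn_matrix_iff.2 fun i j => (h i j).continuousOn

theorem continuousOn_dt (h : ContDiffOnStrip tmax v) :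
    ContinuousOn (fun p : ℝ × ℝ => dt tmax v p.1 p.2) (halfStrip tmax) :=
  continuousOn_matrix_iff.2 fun i j => continuousOn_derivWithin_snd (h i j)

end ContDiffOnStrip

theorem IsC1OnStrip.continuousOn {A : ℝ → ℝ → ℂ → Mat2 m} (h : IsC1OnStrip tmax A) (z : ℂ) :
    ContinuousOn (fun p : ℝ × ℝ => A p.1 p.2 z) (halfStrip tmax) :=
  continuousOn_matrix_iff.2 fun i j => (h z i j).continuousOn

theorem IsC1OnStrip.continuousOn_fst {A : ℝ → ℝ → ℂ → Mat2 m} (h : IsC1OnStrip tmax A) (z : ℂ)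
    {t : ℝ} (ht : t ∈ timeSet tmax) : ContinuousOn (fun x => A x t z) (Ici 0) :=
  (h.continuousOn z).comp (f := fun x => (x, t)) (by fun_prop) fun _ hx => ⟨hx, ht⟩

theorem IsC1OnStrip.continuousOn_snd {A : ℝ → ℝ → ℂ → Mat2 m} (h : IsC1OnStrip tmax A) (z : ℂ)
    {x : ℝ} (hx : 0 ≤ x) : ContinuousOn (fun t => A x t z) (timeSet tmax) :=
  (h.continuousOn z).comp (f := fun t => (x, t)) (by fun_prop) fun _ ht => ⟨hx, ht⟩

variable {u : ℝ → ℝ → Mat m}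

theorem contDiffOnStrip_of_G (hG : IsC1OnStrip tmax (G u)) : ContDiffOnStrip tmax u := fun i j => by
  have := hG 0 (Sum.inr i) (Sum.inl j)
  simpa [G] using this

theorem contDiffOnStrip_dx_of_F (hF : IsC1OnStrip tmax (F u)) : ContDiffOnStrip tmax (dx u) :=
  fun i j => hF 0 (Sum.inl i) (Sum.inl j)

/-- The lower left block of F at z = 0 is u_xx - 2u², so u_xx is recovered by adding 2u². This makes
u_xxx a genuine derivative. -/
theorem contDiffOnStrip_dx_dx (hG : IsC1OnStrip tmax (G u)) (hF : IsC1OnStrip tmax (F u)) :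
    ContDiffOnStrip tmax (dx (dx u)) := fun i j => by
  have h1 := hF 0 (Sum.inr i) (Sum.inl j)
  have hu := contDiffOnStrip_of_G hG
  have h2 : ContDiffOn ℝ 1 (fun p : ℝ × ℝ => 2 * ∑ k, u p.1 p.2 i k * u p.1 p.2 k j)
      (halfStrip tmax) :=
    contDiffOn_const.mul (ContDiffOn.sum fun k _ => (hu i k).mul (hu k j))
  refine (h1.add h2).congr fun p _ => ?_
  simp [F, Matrix.mul_apply]

/-- The derivative in `x` of the coefficient `F`. -/
noncomputable def Fx (u : ℝ → ℝ → Mat m) (x t : ℝ) (z : ℂ) : Mat2 m :=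
  fromBlocks
    (dx (dx u) x t)
    ((-2 : ℂ) • dx u x t)
    (dx (dx (dx u)) x t
      - (2 : ℂ) • (dx u x t * (u x t - z • (1 : Mat m))
        + (u x t + (2 * z) • (1 : Mat m)) * dx u x t))
    (-(dx (dx u) x t))

theorem hasDerivWithinAt_F (hG : IsC1OnStrip tmax (G u)) (hF : IsC1OnStrip tmax (F u)) {x t : ℝ}
    (hx : 0 ≤ x) (ht : t ∈ timeSet tmax) (z : ℂ) :
    HasDerivWithinAt (fun y => F u y t z) (Fx u x t z) (Ici 0) x := by
  have h0 := (contDiffOnStrip_of_G hG).hasDerivWithinAt_dx hx ht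
  have h1 := (contDiffOnStrip_dx_of_F hF).hasDerivWithinAt_dx hx ht
  have h2 := (contDiffOnStrip_dx_dx hG hF).hasDerivWithinAt_dx hx ht
  exact hasDerivWithinAt_fromBlocks h1 ((h0.add_const _).const_smul (-2 : ℂ))
    (h2.sub (((h0.add_const _).mul (h0.sub_const _)).const_smul (2 : ℂ))) h1.neg

/-- The derivative in `t` of the coefficient `G`. -/
noncomputable def Gt (tmax : EReal) (u : ℝ → ℝ → Mat m) (x t : ℝ) : Mat2 m :=
  fromBlocks 0 0 (dt tmax u x t) 0

theorem hasDerivWithinAt_G (hG : IsC1OnStrip tmax (G u)) {x t : ℝ}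
    (hx : 0 ≤ x) (ht : t ∈ timeSet tmax) (z : ℂ) :
    HasDerivWithinAt (fun s => G u x s z) (Gt tmax u x t) (timeSet tmax) t := by
  have h0 := (contDiffOnStrip_of_G hG).hasDerivWithinAt_dt hx ht
  exact hasDerivWithinAt_fromBlocks (hasDerivWithinAt_const _ _ _) (hasDerivWithinAt_const _ _ _)
    (h0.sub_const _) (hasDerivWithinAt_const _ _ _)

theorem continuousOn_Gt (hG : IsC1OnStrip tmax (G u)) :
    ContinuousOn (fun p : ℝ × ℝ => Gt tmax u p.1 p.2) (halfStrip tmax) := by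
  refine continuousOn_matrix_iff.2 ?_
  have h := continuousOn_matrix_iff.1 (contDiffOnStrip_of_G hG).continuousOn_dt
  rintro (i | i) (j | j)
  · exact continuousOn_const
  · exact continuousOn_const
  · exact h i j
  · exact continuousOn_const

/-- The zero curvature form of the matrix KdV equation. -/
theorem zeroCurvature (hu : SolvesKdV tmax u) {x t : ℝ} (hx : 0 ≤ x) (ht : t ∈ timeSet tmax)
    (z : ℂ) :
    Fx u x t z + F u x t z * G u x t z = Gt tmax u x t + G u x t z * F u x t z := by
  have h := hu x t hx ht
  have h' : dx (dx (dx u)) x t = dt tmax u x t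
      + (3 : ℂ) • (u x t * dx u x t + dx u x t * u x t) := (sub_eq_zero.1 h).symm
  simp only [Fx, F, G, Gt, fromBlocks_multiply, fromBlocks_add, h']
  -- Only the lower left block uses KdV; the other three are algebraic identities.
  congr 1
  · simp only [mul_zero, zero_mul, one_mul, zero_add, neg_smul, neg_mul, Matrix.smul_mul]
    abel
  · simp only [mul_zero, zero_mul, mul_one, one_mul, zero_add, add_zero]
    module
  · simp only [mul_zero, zero_mul, mul_one, one_mul, zero_add, mul_sub, sub_mul,
      add_mul, Matrix.smul_mul, Matrix.mul_smul, neg_mul]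
    module
  · simp only [mul_zero, zero_mul, mul_one, one_mul, zero_add, add_zero, mul_sub, sub_mul,
      add_mul, Matrix.mul_add, Matrix.smul_mul, Matrix.mul_smul]
    module

end Strip

/-! ### Dependence on time of the fundamental solution -/

section TimeDependence

variable {m : ℕ} {tmax : EReal} {u : ℝ → ℝ → Mat m} {Ψ : ℝ → ℝ → ℂ → Mat2 m}

theorem eventually_norm_sub_le {f : ℝ → ℝ → Mat2 m}
    (hf : ContinuousOn (fun p : ℝ × ℝ => f p.1 p.2) (halfStrip tmax)) {t : ℝ}
    (ht : t ∈ timeSet tmax) (X : ℝ) {ε : ℝ} (hε : 0 < ε) :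
    ∀ᶠ s in 𝓝[timeSet tmax] t, ∀ x ∈ Icc 0 X, ‖f x s - f x t‖ ≤ ε := by
  have hc : ContinuousOn (Function.uncurry fun s x => f x s) (timeSet tmax ×ˢ Icc 0 X) :=
    hf.comp (f := fun p : ℝ × ℝ => (p.2, p.1)) (by fun_prop) fun p hp => ⟨hp.2.1, hp.1⟩
  obtain ⟨v, hv, h⟩ := isCompact_Icc.mem_uniformity_of_prod hc ht (Metric.dist_mem_uniformity hε)
  filter_upwards [hv] with s hs x hx
  rw [← dist_eq_norm]
  exact le_of_lt (h s hs x hx)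

/-- The mean value inequality for G(s) - s G_t(t) reduces the first order expansion of G to the
continuity of G_t, which is uniform for x in a compact interval. -/
theorem eventually_norm_G_sub_sub_le (hG : IsC1OnStrip tmax (G u)) {t : ℝ}
    (ht : t ∈ timeSet tmax) (z : ℂ) (X : ℝ) {ε : ℝ} (hε : 0 < ε) :
    ∀ᶠ s in 𝓝[timeSet tmax] t, ∀ x ∈ Icc 0 X,
      ‖G u x s z - G u x t z - (s - t) • Gt tmax u x t‖ ≤ ε * |s - t| := by
  obtain ⟨r, hr, hsub⟩ := Metric.mem_nhdsWithin_iff.1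
    (eventually_norm_sub_le (continuousOn_Gt hG) ht X hε)
  filter_upwards [self_mem_nhdsWithin, mem_nhdsWithin_of_mem_nhds (Metric.ball_mem_nhds t hr)]
    with s hs hsr x hx
  have h := ((convex_ball t r).inter (isInitialInterval_timeSet tmax).convex
    ).norm_image_sub_le_of_norm_hasDerivWithin_le
    (f := fun s => G u x s z - s • Gt tmax u x t) (f' := fun s => Gt tmax u x s - Gt tmax u x t)
    (C := ε) (x := t) (y := s)
    (fun s hs => by
      have h1 := (hasDerivWithinAt_G hG hx.1 hs.2 z).sub
        ((hasDerivWithinAt_id s (timeSet tmax)).smul_const (Gt tmax u x t))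
      rw [one_smul] at h1
      exact h1.mono inter_subset_right)
    (fun s hs => hsub hs x hx) ⟨Metric.mem_ball_self hr, ht⟩ ⟨hsr, hs⟩
  rw [Real.norm_eq_abs] at h
  have e : G u x s z - G u x t z - (s - t) • Gt tmax u x t =
      G u x s z - s • Gt tmax u x t - (G u x t z - t • Gt tmax u x t) := by
    rw [sub_smul]
    abel
  rw [e]
  exact h

theorem exists_norm_le_Icc {f : ℝ → Mat2 m} (hf : ContinuousOn f (Ici 0)) (X : ℝ) :
    ∃ C : ℝ, 0 ≤ C ∧ ∀ x ∈ Icc 0 X, ‖f x‖ ≤ C := by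
  obtain ⟨C, hC⟩ := isCompact_Icc.exists_bound_of_continuousOn (hf.mono Icc_subset_Ici_self)
  exact ⟨max C 0, le_max_right _ _, fun x hx => (hC x hx).trans (le_max_left _ _)⟩

theorem IsXFundamental.hasDerivWithinAt (hΨ : IsXFundamental tmax u Ψ) {x t : ℝ} (hx : 0 ≤ x)
    (ht : t ∈ timeSet tmax) (z : ℂ) :
    HasDerivWithinAt (fun y => Ψ y t z) (G u x t z * Ψ x t z) (Ici 0) x :=
  (hΨ t ht z).2 x hx

theorem IsXFundamental.continuousOn_fst (hΨ : IsXFundamental tmax u Ψ) {t : ℝ}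
    (ht : t ∈ timeSet tmax) (z : ℂ) : ContinuousOn (fun y => Ψ y t z) (Ici 0) :=
  fun _ hx => (hΨ.hasDerivWithinAt hx ht z).continuousWithinAt

theorem gronwallBound_zero_one_nonneg {K X : ℝ} (hK : 0 ≤ K) (hX : 0 ≤ X) :
    0 ≤ gronwallBound 0 K 1 X := by
  have := gronwallBound_mono (δ := 0) le_rfl zero_le_one hK hX
  rwa [gronwallBound_x0] at this

theorem IsXFundamental.eventually_norm_sub_le (hΨ : IsXFundamental tmax u Ψ)
    (hG : IsC1OnStrip tmax (G u)) {t : ℝ} (ht : t ∈ timeSet tmax) (z : ℂ) {X : ℝ} (hX : 0 ≤ X)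
    {ε : ℝ} (hε : 0 < ε) :
    ∀ᶠ s in 𝓝[timeSet tmax] t, ∀ x ∈ Icc 0 X, ‖Ψ x s z - Ψ x t z‖ ≤ ε := by
  obtain ⟨K, hK0, hK⟩ := exists_norm_le_Icc (hG.continuousOn_fst z ht) X
  obtain ⟨C, hC0, hC⟩ := exists_norm_le_Icc (hΨ.continuousOn_fst ht z) X
  set Γ := gronwallBound 0 (K + 1) 1 X
  have hΓ : 0 ≤ Γ := gronwallBound_zero_one_nonneg (by positivity) hX
  -- Chosen so that the Grönwall factor CΓ brings the error back below ε; the added 1 keeps the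
  -- denominator positive.
  set ε' := ε / (C * Γ + 1)
  have hε' : 0 < ε' := by positivity
  filter_upwards [self_mem_nhdsWithin,
    MatrixKdV.eventually_norm_sub_le (f := fun x t => G u x t z) (hG.continuousOn z) ht X hε',
    MatrixKdV.eventually_norm_sub_le (f := fun x t => G u x t z) (hG.continuousOn z) ht X one_pos]
    with s hs h1 h2 x hx
  have h := norm_le_of_norm_deriv_le (X := X) (K := K + 1) (ε := ε' * C)
    (fun x hx => ((hΨ.hasDerivWithinAt hx.1 hs z).sub
      (hΨ.hasDerivWithinAt hx.1 ht z)).mono Icc_subset_Ici_self)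
    (by simp [(hΨ s hs z).1, (hΨ t ht z).1]) (fun x hx => by
      have e1 : G u x s z * Ψ x s z - G u x t z * Ψ x t z =
          G u x s z * (Ψ x s z - Ψ x t z) + (G u x s z - G u x t z) * Ψ x t z := by noncomm_ring
      have e2 : ‖G u x s z‖ ≤ K + 1 := by
        have := norm_le_norm_add_norm_sub' (G u x s z) (G u x t z)
        linarith [hK x hx, h2 x hx]
      rw [e1]
      refine (norm_add_le _ _).trans (add_le_add ?_ ?_)
      · exact (norm_mul_le _ _).trans (mul_le_mul_of_nonneg_right e2 (norm_nonneg _))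
      · exact (norm_mul_le _ _).trans
          (mul_le_mul (h1 x hx) (hC x hx) (norm_nonneg _) hε'.le))
    (by positivity) (by positivity) x hx
  refine h.trans ?_
  change ε / (C * Γ + 1) * C * Γ ≤ ε
  rw [mul_assoc, div_mul_eq_mul_div]
  exact div_le_of_le_mul₀ (by positivity) hε.le (by nlinarith)

/-- The fundamental solution is jointly continuous on the half-strip. -/
theorem IsXFundamental.continuousOn (hΨ : IsXFundamental tmax u Ψ)
    (hG : IsC1OnStrip tmax (G u)) (z : ℂ) :
    ContinuousOn (fun p : ℝ × ℝ => Ψ p.1 p.2 z) (halfStrip tmax) := by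
  rintro ⟨x, t⟩ ⟨hx, ht⟩
  have hx : 0 ≤ x := hx
  have ht : t ∈ timeSet tmax := ht
  rw [ContinuousWithinAt, halfStrip, nhdsWithin_prod_eq]
  refine Metric.tendsto_nhds.2 ?_
  intro ε hε
  have h1 := hΨ.eventually_norm_sub_le hG ht z (by linarith : 0 ≤ x + 1) (half_pos hε)
  have h2 := Metric.tendsto_nhds.1 (hΨ.continuousOn_fst ht z x hx) _ (half_pos hε)
  have h3 : ∀ᶠ y in 𝓝[Ici 0] x, y ∈ Icc 0 (x + 1) := by
    exact isInitialInterval_Ici.Icc_mem_nhdsWithin (lt_add_one x)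
  filter_upwards [(h2.and h3).prod_mk h1] with p hp
  have e1 := hp.2 p.1 hp.1.2
  rw [← dist_eq_norm] at e1
  linarith [dist_triangle (Ψ p.1 p.2 z) (Ψ p.1 t z) (Ψ x t z), hp.1.1]

/-- The evolution in `t` of the fundamental solution of the `x`-system. -/
theorem IsXFundamental.hasDerivWithinAt_snd (hΨ : IsXFundamental tmax u Ψ)
    (hG : IsC1OnStrip tmax (G u)) (hF : IsC1OnStrip tmax (F u)) (hu : SolvesKdV tmax u)
    {x t : ℝ} (hx : 0 ≤ x) (ht : t ∈ timeSet tmax) (z : ℂ) :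
    HasDerivWithinAt (fun s => Ψ x s z) (F u x t z * Ψ x t z - Ψ x t z * F u 0 t z)
      (timeSet tmax) t := by
  set D : ℝ → Mat2 m := fun x => F u x t z * Ψ x t z - Ψ x t z * F u 0 t z
  -- Zero curvature shows that the candidate D for Ψ_t solves the x-equation differentiated formally
  -- in t; moreover D vanishes at x = 0.
  have hD : ∀ y, 0 ≤ y → HasDerivWithinAt D (G u y t z * D y + Gt tmax u y t * Ψ y t z)
      (Ici 0) y := fun y hy => by
    have h1 := (hasDerivWithinAt_F hG hF hy ht z).mul (hΨ.hasDerivWithinAt hy ht z)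
    have h2 := (hΨ.hasDerivWithinAt hy ht z).mul_const (F u 0 t z)
    refine (h1.sub h2).congr_deriv ?_
    have h3 : Fx u y t z * Ψ y t z + F u y t z * (G u y t z * Ψ y t z) =
        Gt tmax u y t * Ψ y t z + G u y t z * F u y t z * Ψ y t z := by
      rw [← mul_assoc, ← add_mul, zeroCurvature hu hy ht z, add_mul]
    rw [h3]
    simp only [D]
    noncomm_ring
  have hDc : ContinuousOn D (Ici 0) := fun y hy => (hD y hy).continuousWithinAt
  obtain ⟨K, hK0, hK⟩ := exists_norm_le_Icc (hG.continuousOn_fst z ht) x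
  obtain ⟨C, hC0, hC⟩ := exists_norm_le_Icc (hΨ.continuousOn_fst ht z) x
  obtain ⟨C', hC0', hC'⟩ := exists_norm_le_Icc hDc x
  set Γ := gronwallBound 0 (K + 1) 1 x
  have hΓ : 0 ≤ Γ := gronwallBound_zero_one_nonneg (by positivity) hx
  refine hasDerivWithinAt_iff_isLittleO.2 (Asymptotics.isLittleO_iff.2 ?_)
  intro ε hε
  set ε' := ε / ((C + C') * Γ + 1)
  have hε' : 0 < ε' := by positivity
  filter_upwards [self_mem_nhdsWithin,
    MatrixKdV.eventually_norm_sub_le (f := fun x t => G u x t z) (hG.continuousOn z) ht x hε',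
    MatrixKdV.eventually_norm_sub_le (f := fun x t => G u x t z) (hG.continuousOn z) ht x one_pos,
    eventually_norm_G_sub_sub_le hG ht z x hε'] with s hs h1 h2 h3
  -- The remainder Ψ(s) - Ψ(t) - (s - t)D vanishes at x = 0 and solves the x-equation at time s up
  -- to an error o(s - t), so Grönwall makes it o(s - t).
  have h := norm_le_of_norm_deriv_le (X := x) (K := K + 1)
    (ε := ε' * |s - t| * C + |s - t| * ε' * C')
    (fun y hy => (((hΨ.hasDerivWithinAt hy.1 hs z).sub
      (hΨ.hasDerivWithinAt hy.1 ht z)).sub ((hD y hy.1).const_smul (s - t))).mono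
      Icc_subset_Ici_self)
    (by simp [D, (hΨ s hs z).1, (hΨ t ht z).1]) (fun y hy => by
      have e1 : G u y s z * Ψ y s z - G u y t z * Ψ y t z -
          (s - t) • (G u y t z * D y + Gt tmax u y t * Ψ y t z) =
          G u y s z * (Ψ y s z - Ψ y t z - (s - t) • D y) +
          ((G u y s z - G u y t z - (s - t) • Gt tmax u y t) * Ψ y t z
            + (s - t) • ((G u y s z - G u y t z) * D y)) := by
        simp only [mul_sub, sub_mul, smul_mul_assoc, mul_smul_comm, smul_add, smul_sub]
        abel
      have e2 : ‖G u y s z‖ ≤ K + 1 := by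
        have := norm_le_norm_add_norm_sub' (G u y s z) (G u y t z)
        linarith [hK y hy, h2 y hy]
      rw [e1]
      refine (norm_add_le _ _).trans (add_le_add ?_ ((norm_add_le _ _).trans (add_le_add ?_ ?_)))
      · exact (norm_mul_le _ _).trans (mul_le_mul_of_nonneg_right e2 (norm_nonneg _))
      · exact (norm_mul_le _ _).trans
          (mul_le_mul (h3 y hy) (hC y hy) (norm_nonneg _) (by positivity))
      · rw [norm_smul, Real.norm_eq_abs, mul_assoc]
        refine mul_le_mul_of_nonneg_left ?_ (abs_nonneg _)
        exact (norm_mul_le _ _).trans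
          (mul_le_mul (h1 y hy) (hC' y hy) (norm_nonneg _) hε'.le))
    (by positivity) (by positivity) x ⟨hx, le_rfl⟩
  refine h.trans ?_
  have e3 : (ε' * |s - t| * C + |s - t| * ε' * C') * Γ = ε' * ((C + C') * Γ) * |s - t| := by ring
  have e4 : ε' * ((C + C') * Γ) ≤ ε := by
    change ε / ((C + C') * Γ + 1) * ((C + C') * Γ) ≤ ε
    rw [div_mul_eq_mul_div]
    exact div_le_of_le_mul₀ (by positivity) hε.le (by nlinarith)
  rw [Real.norm_eq_abs]
  change (ε' * |s - t| * C + |s - t| * ε' * C') * Γ ≤ _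
  rw [e3]
  exact mul_le_mul_of_nonneg_right e4 (abs_nonneg _)

end TimeDependence

/-! ### Existence of both fundamental solutions -/

section Existence

variable {m : ℕ} {tmax : EReal} {u : ℝ → ℝ → Mat m}

theorem exists_isXFundamental (hG : IsC1OnStrip tmax (G u)) :
    ∃ Ψ : ℝ → ℝ → ℂ → Mat2 m, IsXFundamental tmax u Ψ := by
  have h : ∀ (t : ℝ) (z : ℂ), ∃ Y : ℝ → Mat2 m, t ∈ timeSet tmax → Y 0 = 1 ∧
      ∀ x : ℝ, 0 ≤ x → HasDerivWithinAt Y (G u x t z * Y x) (Ici 0) x := fun t z => by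
    by_cases ht : t ∈ timeSet tmax
    · obtain ⟨Y, hY⟩ := exists_linearODE isInitialInterval_Ici (hG.continuousOn_fst z ht) 1
      exact ⟨Y, fun _ => hY⟩
    · exact ⟨0, fun h => absurd h ht⟩
  choose Y hY using h
  exact ⟨fun x t z => Y t z x, fun t ht z => hY t z ht⟩

theorem exists_isTFundamental (hF : IsC1OnStrip tmax (F u)) :
    ∃ V : ℝ → ℝ → ℂ → Mat2 m, IsTFundamental tmax u V := by
  have h : ∀ (x : ℝ) (z : ℂ), ∃ Y : ℝ → Mat2 m, 0 ≤ x → Y 0 = 1 ∧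
      ∀ t ∈ timeSet tmax, HasDerivWithinAt Y (F u x t z * Y t) (timeSet tmax) t := fun x z => by
    by_cases hx : 0 ≤ x
    · obtain ⟨Y, hY⟩ :=
        exists_linearODE (isInitialInterval_timeSet tmax) (hF.continuousOn_snd z hx) 1
      exact ⟨Y, fun _ => hY⟩
    · exact ⟨0, fun h => absurd h hx⟩
  choose Y hY using h
  exact ⟨fun x t z => Y x z t, fun x hx z => hY x z hx⟩

end Existence

/-! ### Quadratic forms along linear systems -/

section Forms

variable {n : Type*} [Fintype n]

/-- The real part of the quadratic form `w* B w`. -/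
noncomputable def qf (B : Matrix n n ℂ) (w : n → ℂ) : ℝ := (star w ⬝ᵥ B *ᵥ w).re

theorem qf_mulVec (B M : Matrix n n ℂ) (w : n → ℂ) : qf B (M *ᵥ w) = qf (Mᴴ * B * M) w := by
  rw [qf, qf, star_mulVec, ← dotProduct_mulVec, mulVec_mulVec, mulVec_mulVec, Matrix.mul_assoc]

theorem qf_add_left (A B : Matrix n n ℂ) (w : n → ℂ) : qf (A + B) w = qf A w + qf B w := by
  simp [qf, add_mulVec, dotProduct_add]

theorem qf_smul_left (c : ℝ) (B : Matrix n n ℂ) (w : n → ℂ) :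
    qf ((c : ℂ) • B) w = c * qf B w := by
  simp [qf, smul_mulVec, dotProduct_smul]

theorem qf_parallelogram (B : Matrix n n ℂ) (v w : n → ℂ) :
    qf B (v - w) + qf B (v + w) = 2 * qf B v + 2 * qf B w := by
  simp only [qf, star_sub, star_add, mulVec_sub, mulVec_add, dotProduct_sub, dotProduct_add,
    sub_dotProduct, add_dotProduct, Complex.sub_re, Complex.add_re]
  ring

theorem qf_smul (B : Matrix n n ℂ) (c : ℝ) (w : n → ℂ) :
    qf B ((c : ℂ) • w) = c ^ 2 * qf B w := by
  simp only [qf, star_smul, mulVec_smul, dotProduct_smul, smul_dotProduct, smul_eq_mul]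
  simp
  ring

theorem continuous_qf (B : Matrix n n ℂ) : Continuous (qf B) := by
  unfold qf
  fun_prop

theorem hasDerivWithinAt_qf_apply {E : ℝ → Matrix n n ℂ} {E' : Matrix n n ℂ} {s : Set ℝ} {x : ℝ}
    [DecidableEq n] (h : HasDerivWithinAt E E' s x) (w : n → ℂ) :
    HasDerivWithinAt (fun y => qf (E y) w) (qf E' w) s x := by
  have h1 : ∀ i j, HasDerivWithinAt (fun y => (star (w i) * (E y i j * w j)).re)
      (star (w i) * (E' i j * w j)).re s x := fun i j =>
    Complex.reCLM.hasFDerivAt.comp_hasDerivWithinAt x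
      (((hasDerivWithinAt_matrix_iff.1 h i j).mul_const (w j)).const_mul (star (w i)))
  have h2 := HasDerivWithinAt.fun_sum (u := Finset.univ)
    fun i _ => HasDerivWithinAt.fun_sum (u := Finset.univ) fun j _ => h1 i j
  simpa only [qf, dotProduct, mulVec, Pi.star_apply, Finset.mul_sum, Complex.re_sum] using h2

theorem hasDerivWithinAt_conjTranspose_mul_mul [DecidableEq n] {X Y : ℝ → Matrix n n ℂ}
    {A B K : Matrix n n ℂ} {s : Set ℝ} {x : ℝ} (hX : HasDerivWithinAt X (A * X x) s x)
    (hY : HasDerivWithinAt Y (B * Y x) s x) :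
    HasDerivWithinAt (fun y => (Y y)ᴴ * K * X y) ((Y x)ᴴ * (Bᴴ * K + K * A) * X x) s x := by
  refine (((hasDerivWithinAt_conjTranspose hY).mul_const K).mul hX).congr_deriv ?_
  rw [conjTranspose_mul]
  noncomm_ring

/-- The derivative of a quadratic form along a linear differential equation. -/
theorem hasDerivWithinAt_qf [DecidableEq n] {X : ℝ → Matrix n n ℂ} {A : Matrix n n ℂ} {s : Set ℝ}
    {x : ℝ} (hX : HasDerivWithinAt X (A * X x) s x) (K : Matrix n n ℂ) (w : n → ℂ) :
    HasDerivWithinAt (fun y => qf K (X y *ᵥ w)) (qf (Aᴴ * K + K * A) (X x *ᵥ w)) s x := by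
  simp only [qf_mulVec]
  exact hasDerivWithinAt_qf_apply (hasDerivWithinAt_conjTranspose_mul_mul hX hX) w

theorem conjTranspose_mul_mul_eq_const {m : ℕ} {X Y A B : ℝ → Mat2 m} {K : Mat2 m} {s : Set ℝ}
    (hs : IsInitialInterval s)
    (hX : ∀ x ∈ s, HasDerivWithinAt X (A x * X x) s x)
    (hY : ∀ x ∈ s, HasDerivWithinAt Y (B x * Y x) s x)
    (hAB : ∀ x ∈ s, (B x)ᴴ * K + K * A x = 0) :
    ∀ x ∈ s, (Y x)ᴴ * K * X x = (Y 0)ᴴ * K * X 0 := by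
  refine linearODE_eqOn (A := fun _ => 0) (Z := fun _ => (Y 0)ᴴ * K * X 0) hs continuousOn_const
    (fun x hx => ?_) (fun x hx => ?_) rfl
  · refine (hasDerivWithinAt_conjTranspose_mul_mul (K := K) (hX x hx) (hY x hx)).congr_deriv ?_
    rw [hAB x hx, mul_zero, zero_mul, zero_mul]
  · exact (hasDerivWithinAt_const x s _).congr_deriv (zero_mul _).symm

end Forms

/-! ### Symplectic algebra and the matrix T -/

section Symplectic

variable {m : ℕ}

/-- The symplectic matrix `[0, I; -I, 0]`. -/
def symp (m : ℕ) : Mat2 m := fromBlocks 0 1 (-1) 0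

/-- The Hermitian matrix `-i [0, I; -I, 0]`. -/
noncomputable def sympForm (m : ℕ) : Mat2 m := (-Complex.I) • symp m

/-- The orthogonal projection `[I, 0; 0, 0]`. -/
def proj₁ (m : ℕ) : Mat2 m := fromBlocks 1 0 0 0

/-- The orthogonal projection `[0, 0; 0, I]`. -/
def proj₂ (m : ℕ) : Mat2 m := fromBlocks 0 0 0 1

theorem symp_mul_symp : symp m * symp m = -1 := by
  simp [symp, fromBlocks_multiply, ← fromBlocks_one, fromBlocks_neg]

theorem conjTranspose_symp : (symp m)ᴴ = -symp m := by
  simp [symp, fromBlocks_conjTranspose, fromBlocks_neg]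

theorem conjTranspose_J : (J m)ᴴ = J m := by
  simp [J, fromBlocks_conjTranspose]

theorem J_mul_J : J m * J m = 1 := by
  simp [J, fromBlocks_multiply, ← fromBlocks_one]

theorem inv_sqrt_two_mul_self : ((Real.sqrt 2 : ℝ) : ℂ)⁻¹ * ((Real.sqrt 2 : ℝ) : ℂ)⁻¹ = 2⁻¹ := by
  rw [← mul_inv, ← Complex.ofReal_mul, Real.mul_self_sqrt (by norm_num)]
  simp

theorem conjTranspose_T : (T m)ᴴ = ((Real.sqrt 2 : ℝ) : ℂ)⁻¹ •
    fromBlocks (-(Complex.I • (1 : Mat m))) (-(Complex.I • (1 : Mat m))) 1 (-1) := by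
  simp [T, conjTranspose_smul, fromBlocks_conjTranspose]

theorem T_mul_conjTranspose : T m * (T m)ᴴ = 1 := by
  rw [conjTranspose_T, T, smul_mul_smul_comm, inv_sqrt_two_mul_self, fromBlocks_multiply,
    fromBlocks_smul, ← fromBlocks_one]
  congr 1 <;> (simp [smul_smul]; try module)

theorem conjTranspose_T_mul : (T m)ᴴ * T m = 1 := mul_eq_one_comm.1 T_mul_conjTranspose

/-- This change of basis links the two structures: the x- and t-systems preserve `symp`, while the
canonical system is written with J. -/
theorem conjTranspose_T_mul_symp_mul : (T m)ᴴ * symp m * T m = Complex.I • J m := by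
  rw [conjTranspose_T, T, symp, J, smul_mul_assoc, smul_mul_smul_comm, inv_sqrt_two_mul_self,
    fromBlocks_multiply, fromBlocks_multiply, fromBlocks_smul, fromBlocks_smul]
  congr 1 <;> (simp [smul_smul]; try module)

theorem conjTranspose_T_mul_symp : (T m)ᴴ * symp m = Complex.I • (J m * (T m)ᴴ) := by
  rw [← smul_mul_assoc, ← conjTranspose_T_mul_symp_mul, mul_assoc, T_mul_conjTranspose, mul_one]

theorem T_mul_J_mul_conjTranspose : T m * J m * (T m)ᴴ = (-Complex.I) • symp m := by
  rw [mul_assoc, ← one_mul (symp m), ← T_mul_conjTranspose, mul_assoc, conjTranspose_T_mul_symp,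
    mul_smul_comm, smul_smul]
  simp

/-- A symplectic relation provides an explicit inverse, so determinants are not needed. -/
theorem mul_eq_one_of_symp {X Y : Mat2 m} (h : Yᴴ * symp m * X = symp m) :
    -(symp m * Yᴴ * symp m) * X = 1 := by
  rw [neg_mul, mul_assoc (symp m), mul_assoc (symp m), h, symp_mul_symp, neg_neg]

theorem mul_eq_one_of_symp' {X Y : Mat2 m} (h : Yᴴ * symp m * X = symp m) :
    X * -(symp m * Yᴴ * symp m) = 1 := mul_eq_one_comm.1 (mul_eq_one_of_symp h)

theorem mul_symp_mul_of_symp {X Y : Mat2 m} (h : Yᴴ * symp m * X = symp m) :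
    X * symp m * Yᴴ = symp m := by
  calc X * symp m * Yᴴ = X * -(symp m * Yᴴ * symp m) * symp m := by
        rw [mul_assoc X (-(symp m * Yᴴ * symp m)), neg_mul, mul_assoc (symp m * Yᴴ), symp_mul_symp]
        noncomm_ring
    _ = symp m := by rw [mul_eq_one_of_symp' h, one_mul]

theorem mulVec_eq_zero_of_mul_eq_one {n : Type*} [Fintype n] [DecidableEq n]
    {X Y : Matrix n n ℂ} (h : Y * X = 1) {w : n → ℂ} (hw : X *ᵥ w = 0) : w = 0 := by
  rw [← one_mulVec w, ← h, ← mulVec_mulVec, hw, mulVec_zero]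

end Symplectic

/-! ### Symplectic identities for G and F -/

section Coefficients

variable {m : ℕ} {tmax : EReal} {u : ℝ → ℝ → Mat m}

theorem conjTranspose_sub_smul_one {a : Mat m} (ha : a.IsHermitian) (z : ℂ) :
    (a - z • (1 : Mat m))ᴴ = a - star z • (1 : Mat m) := by
  rw [conjTranspose_sub, ha.eq, conjTranspose_smul, conjTranspose_one]

theorem conjTranspose_G (hsa : IsSelfAdjointOnStrip tmax u) {x t : ℝ} (hx : 0 ≤ x)
    (ht : t ∈ timeSet tmax) (z : ℂ) :
    (G u x t z)ᴴ = fromBlocks 0 (u x t - star z • (1 : Mat m)) 1 0 := by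
  rw [G, fromBlocks_conjTranspose, conjTranspose_sub_smul_one (hsa x t hx ht)]
  simp

theorem G_symp (hsa : IsSelfAdjointOnStrip tmax u) {x t : ℝ} (hx : 0 ≤ x)
    (ht : t ∈ timeSet tmax) (z w : ℂ) :
    (G u x t w)ᴴ * symp m + symp m * G u x t z = (star w - z) • proj₁ m := by
  rw [conjTranspose_G hsa hx ht, G, symp, proj₁, fromBlocks_multiply, fromBlocks_multiply,
    fromBlocks_add, fromBlocks_smul]
  congr 1 <;> simp <;> module

theorem G_sympForm (hsa : IsSelfAdjointOnStrip tmax u) {x t : ℝ} (hx : 0 ≤ x)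
    (ht : t ∈ timeSet tmax) (z : ℂ) :
    (G u x t z)ᴴ * sympForm m + sympForm m * G u x t z = ((-2 * z.im : ℝ) : ℂ) • proj₁ m := by
  rw [sympForm, mul_smul_comm, smul_mul_assoc, ← smul_add, G_symp hsa hx ht, smul_smul]
  congr 1
  apply Complex.ext <;> simp
  ring

theorem isSelfAdjointOnStrip_dx {v : ℝ → ℝ → Mat m} (hv : ContDiffOnStrip tmax v)
    (hsa : IsSelfAdjointOnStrip tmax v) : IsSelfAdjointOnStrip tmax (dx v) := fun x t hx ht => by
  have h1 := hv.hasDerivWithinAt_dx hx ht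
  have h2 := (hasDerivWithinAt_conjTranspose h1).congr (fun y hy => (hsa y t hy ht).eq.symm)
    (hsa x t hx ht).eq.symm
  exact UniqueDiffWithinAt.eq_deriv _ (isInitialInterval_Ici.uniqueDiffOn x hx) h2 h1

theorem conjTranspose_F (hsa : IsSelfAdjointOnStrip tmax u) (hG : IsC1OnStrip tmax (G u))
    (hF : IsC1OnStrip tmax (F u)) {x t : ℝ} (hx : 0 ≤ x) (ht : t ∈ timeSet tmax) (z : ℂ) :
    (F u x t z)ᴴ = fromBlocks (dx u x t)
      (dx (dx u) x t - (2 : ℂ) • ((u x t - star z • (1 : Mat m))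
        * (u x t + (2 * star z) • (1 : Mat m))))
      ((-2 : ℂ) • (u x t + (2 * star z) • (1 : Mat m))) (-(dx u x t)) := by
  have hdx := isSelfAdjointOnStrip_dx (contDiffOnStrip_of_G hG) hsa
  have hdxx := isSelfAdjointOnStrip_dx (contDiffOnStrip_dx_of_F hF) hdx
  have h1 := hsa x t hx ht
  rw [F, fromBlocks_conjTranspose, conjTranspose_neg, (hdx x t hx ht).eq]
  simp only [conjTranspose_sub, conjTranspose_smul, conjTranspose_mul, conjTranspose_add,
    h1.eq, (hdxx x t hx ht).eq, conjTranspose_one]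
  simp

theorem F_symp (hsa : IsSelfAdjointOnStrip tmax u) (hG : IsC1OnStrip tmax (G u))
    (hF : IsC1OnStrip tmax (F u)) {x t : ℝ} (hx : 0 ≤ x) (ht : t ∈ timeSet tmax) (z : ℂ) :
    (F u x t (star z))ᴴ * symp m + symp m * F u x t z = 0 := by
  rw [conjTranspose_F hsa hG hF hx ht, star_star, F, symp, fromBlocks_multiply,
    fromBlocks_multiply, fromBlocks_add, ← fromBlocks_zero]
  congr 1 <;> simp [mul_sub, sub_mul, add_mul, Matrix.mul_add]

/-- The terms with u_x and u_xx are self-adjoint and cancel, so the rate of change of the energy in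
t involves only u and z. The boundedness of u therefore suffices to control it. -/
theorem F_sympForm (hsa : IsSelfAdjointOnStrip tmax u) (hG : IsC1OnStrip tmax (G u))
    (hF : IsC1OnStrip tmax (F u)) {x t : ℝ} (hx : 0 ≤ x) (ht : t ∈ timeSet tmax) (z : ℂ) :
    (F u x t z)ᴴ * sympForm m + sympForm m * F u x t z =
      ((-4 * z.im : ℝ) : ℂ) • fromBlocks (u x t) 0 0 0 + ((16 * z.re * z.im : ℝ) : ℂ) • proj₁ m
        + ((8 * z.im : ℝ) : ℂ) • proj₂ m := by
  obtain ⟨a, b, rfl⟩ : ∃ a b : ℝ, z = a + b * Complex.I := ⟨z.re, z.im, (Complex.re_add_im z).symm⟩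
  have hstar : star ((a : ℂ) + b * Complex.I) = a - b * Complex.I := by
    apply Complex.ext <;> simp
  rw [conjTranspose_F hsa hG hF hx ht, F, sympForm, symp, proj₁, proj₂, fromBlocks_smul,
    fromBlocks_multiply, fromBlocks_multiply, fromBlocks_smul, fromBlocks_smul, fromBlocks_smul,
    fromBlocks_add, fromBlocks_add, fromBlocks_add, hstar]
  congr 1
  · simp [mul_sub, sub_mul, add_mul, Matrix.mul_add]
    match_scalars <;> (apply Complex.ext <;> (simp; try ring))
  · simp
  · simp
  · simp
    match_scalars <;> (apply Complex.ext <;> (simp; try ring))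

end Coefficients

/-! ### Solution of the canonical system -/

section Canonical

variable {m : ℕ} {tmax : EReal} {u : ℝ → ℝ → Mat m} {Ψ V : ℝ → ℝ → ℂ → Mat2 m}

theorem IsXFundamental.symp (hΨ : IsXFundamental tmax u Ψ) (hsa : IsSelfAdjointOnStrip tmax u)
    {x t : ℝ} (hx : 0 ≤ x) (ht : t ∈ timeSet tmax) (z : ℂ) :
    (Ψ x t (star z))ᴴ * symp m * Ψ x t z = symp m := by
  have h := conjTranspose_mul_mul_eq_const (K := MatrixKdV.symp m) isInitialInterval_Ici
    (fun x hx => hΨ.hasDerivWithinAt hx ht z) (fun x hx => hΨ.hasDerivWithinAt hx ht (star z))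
    (fun x hx => by rw [G_symp hsa hx ht, star_star, sub_self, zero_smul]) x hx
  rwa [(hΨ t ht z).1, (hΨ t ht (star z)).1, conjTranspose_one, one_mul, mul_one] at h

theorem IsXFundamental.symp_zero (hΨ : IsXFundamental tmax u Ψ)
    (hsa : IsSelfAdjointOnStrip tmax u) {x t : ℝ} (hx : 0 ≤ x) (ht : t ∈ timeSet tmax) :
    (Ψ x t 0)ᴴ * MatrixKdV.symp m * Ψ x t 0 = MatrixKdV.symp m := by
  simpa using hΨ.symp hsa hx ht 0

theorem IsTFundamental.symp (hV : IsTFundamental tmax u V) (hsa : IsSelfAdjointOnStrip tmax u)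
    (hG : IsC1OnStrip tmax (G u)) (hF : IsC1OnStrip tmax (F u)) {x t : ℝ} (hx : 0 ≤ x)
    (ht : t ∈ timeSet tmax) (z : ℂ) :
    (V x t (star z))ᴴ * MatrixKdV.symp m * V x t z = MatrixKdV.symp m := by
  have h := conjTranspose_mul_mul_eq_const (K := MatrixKdV.symp m) (isInitialInterval_timeSet tmax)
    (fun t ht => (hV x hx z).2 t ht) (fun t ht => (hV x hx (star z)).2 t ht)
    (fun t ht => F_symp hsa hG hF hx ht z) t ht
  rwa [(hV x hx z).1, (hV x hx (star z)).1, conjTranspose_one, one_mul, mul_one] at h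

/-- The fundamental solution of the canonical system, in terms of that of the `x`-system. -/
noncomputable def canonicalSolution (Ψ : ℝ → ℝ → ℂ → Mat2 m) (t x : ℝ) (z : ℂ) : Mat2 m :=
  -((T m)ᴴ * symp m * ((Ψ x t 0)ᴴ * symp m * Ψ x t z) * T m)

theorem isCanonicalFundamental_canonicalSolution (hΨ : IsXFundamental tmax u Ψ)
    (hsa : IsSelfAdjointOnStrip tmax u) {t : ℝ} (ht : t ∈ timeSet tmax) :
    IsCanonicalFundamental (fun x => hamiltonian Ψ x t) (canonicalSolution Ψ t) := by
  refine fun z => ⟨?_, fun x hx => ?_⟩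
  · simp only [canonicalSolution, (hΨ t ht z).1, (hΨ t ht 0).1, conjTranspose_one, one_mul, mul_one]
    rw [mul_assoc (T m)ᴴ, symp_mul_symp, mul_neg, mul_one, neg_mul, neg_neg, conjTranspose_T_mul]
  · have h1 := hasDerivWithinAt_conjTranspose_mul_mul (K := symp m) (hΨ.hasDerivWithinAt hx ht z)
      (hΨ.hasDerivWithinAt hx ht 0)
    rw [G_symp hsa hx ht, star_zero, zero_sub] at h1
    refine ((h1.const_mul ((T m)ᴴ * symp m)).mul_const (T m)).neg.congr_deriv ?_
    have h2 := mul_eq_one_of_symp' (hΨ.symp_zero hsa hx ht)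
    have h3 : hamiltonian Ψ x t * canonicalSolution Ψ t x z =
        (T m)ᴴ * ((Ψ x t 0)ᴴ * proj₁ m * Ψ x t z) * T m := by
      calc hamiltonian Ψ x t * canonicalSolution Ψ t x z
          = (T m)ᴴ * (Ψ x t 0)ᴴ * proj₁ m * Ψ x t 0 * ((T m * (T m)ᴴ) *
            -(symp m * (Ψ x t 0)ᴴ * symp m)) * Ψ x t z * T m := by
            rw [hamiltonian, canonicalSolution, proj₁]
            noncomm_ring
        _ = (T m)ᴴ * (Ψ x t 0)ᴴ * proj₁ m * (Ψ x t 0 *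
            -(symp m * (Ψ x t 0)ᴴ * symp m)) * Ψ x t z * T m := by
            rw [T_mul_conjTranspose]
            noncomm_ring
        _ = _ := by
            rw [h2]
            noncomm_ring
    rw [mul_assoc (J m), h3, conjTranspose_T_mul_symp]
    simp only [mul_smul_comm, smul_mul_assoc, mul_assoc, smul_smul, neg_smul, mul_neg, neg_neg,
      neg_mul]
    rw [mul_comm]

theorem IsCanonicalFundamental.eq_canonicalSolution {W : ℝ → ℂ → Mat2 m} {t : ℝ}
    (hW : IsCanonicalFundamental (fun x => hamiltonian Ψ x t) W)
    (hΨ : IsXFundamental tmax u Ψ) (hsa : IsSelfAdjointOnStrip tmax u)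
    (ht : t ∈ timeSet tmax) {x : ℝ} (hx : 0 ≤ x) (z : ℂ) :
    W x z = canonicalSolution Ψ t x z := by
  have hc : ContinuousOn (fun x => (Complex.I * z) • (J m * hamiltonian Ψ x t)) (Ici 0) := by
    have h0 := hΨ.continuousOn_fst ht 0
    have h1 : ContinuousOn (fun x => (Ψ x t 0)ᴴ) (Ici 0) :=
      fun x hx => (hasDerivWithinAt_conjTranspose (hΨ.hasDerivWithinAt hx ht 0)).continuousWithinAt
    unfold hamiltonian
    fun_prop
  have hW' := isCanonicalFundamental_canonicalSolution hΨ hsa ht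
  refine linearODE_eqOn (Y := fun x => W x z) (Z := fun x => canonicalSolution Ψ t x z)
    isInitialInterval_Ici hc (fun x hx => ?_) (fun x hx => ?_)
    ((hW z).1.trans (hW' z).1.symm) x hx
  · exact ((hW z).2 x hx).congr_deriv (smul_mul_assoc _ _ _).symm
  · exact ((hW' z).2 x hx).congr_deriv (smul_mul_assoc _ _ _).symm

/-- The adjoint of T*Ψ(0)⁻¹Ψ(z̄)T contributes Ψ(z̄)*, and Ψ(z) `symp` Ψ(z̄)* = `symp` removes the
spectral parameter. -/
theorem mul_conjTranspose_canonicalSolution (hΨ : IsXFundamental tmax u Ψ)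
    (hsa : IsSelfAdjointOnStrip tmax u) {x t : ℝ} (hx : 0 ≤ x) (ht : t ∈ timeSet tmax) (z : ℂ) :
    Ψ x t z * T m * J m * (canonicalSolution Ψ t x (star z))ᴴ =
      (-Complex.I) • (Ψ x t 0 * symp m * T m) := by
  have h1 := mul_symp_mul_of_symp (hΨ.symp hsa hx ht z)
  calc Ψ x t z * T m * J m * (canonicalSolution Ψ t x (star z))ᴴ
      = Ψ x t z * (T m * J m * (T m)ᴴ) * (Ψ x t (star z))ᴴ * -(symp m) * Ψ x t 0 * symp m
          * T m := by
        simp only [canonicalSolution, conjTranspose_neg, conjTranspose_mul,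
          conjTranspose_conjTranspose, conjTranspose_symp]
        noncomm_ring
    _ = (-Complex.I) • ((Ψ x t z * symp m * (Ψ x t (star z))ᴴ) * -(symp m) * Ψ x t 0 * symp m
          * T m) := by
        rw [T_mul_J_mul_conjTranspose]
        simp only [mul_smul_comm, smul_mul_assoc]
    _ = _ := by
        rw [h1, mul_neg, symp_mul_symp, neg_neg, one_mul]

/-- The factor left by the cancellation, -iΨ(x,t,0) `symp` T, carries the energy form to J. Thus
J-nonnegative pairs correspond to nonnegative energy at the right end point. -/
theorem qf_sympForm_canonicalSolution (hΨ : IsXFundamental tmax u Ψ)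
    (hsa : IsSelfAdjointOnStrip tmax u) {x t : ℝ} (hx : 0 ≤ x) (ht : t ∈ timeSet tmax) (z : ℂ)
    (a : Fin m ⊕ Fin m → ℂ) :
    qf (sympForm m) ((Ψ x t z * T m * J m) *ᵥ ((canonicalSolution Ψ t x (star z))ᴴ *ᵥ a)) =
      qf (J m) a := by
  rw [mulVec_mulVec, mul_conjTranspose_canonicalSolution hΨ hsa hx ht, qf_mulVec]
  congr 1
  have h0 := hΨ.symp_zero hsa hx ht
  calc ((-Complex.I) • (Ψ x t 0 * symp m * T m))ᴴ * sympForm m *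
        ((-Complex.I) • (Ψ x t 0 * symp m * T m))
      = (-Complex.I) • (-((T m)ᴴ * symp m * ((Ψ x t 0)ᴴ * symp m * Ψ x t 0) * symp m * T m)) := by
        simp only [conjTranspose_smul, conjTranspose_mul, conjTranspose_symp, sympForm,
          smul_mul_assoc, mul_smul_comm, smul_smul]
        simp [mul_assoc]
    _ = (-Complex.I) • ((T m)ᴴ * symp m * T m) := by
        rw [h0, mul_assoc (T m)ᴴ, symp_mul_symp]
        noncomm_ring
    _ = J m := by
        rw [conjTranspose_T_mul_symp_mul, smul_smul]
        simp

theorem mulVec_conjTranspose_canonicalSolution_eq_zero (hΨ : IsXFundamental tmax u Ψ)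
    (hsa : IsSelfAdjointOnStrip tmax u) {x t : ℝ} (hx : 0 ≤ x) (ht : t ∈ timeSet tmax) (z : ℂ)
    {a : Fin m ⊕ Fin m → ℂ} (ha : (canonicalSolution Ψ t x (star z))ᴴ *ᵥ a = 0) : a = 0 := by
  have h : (Ψ x t z * T m * J m) *ᵥ ((canonicalSolution Ψ t x (star z))ᴴ *ᵥ a) = 0 := by
    rw [ha, mulVec_zero]
  rw [mulVec_mulVec, mul_conjTranspose_canonicalSolution hΨ hsa hx ht, smul_mulVec,
    smul_eq_zero_iff_right (neg_ne_zero.2 Complex.I_ne_zero), ← mulVec_mulVec,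
    ← mulVec_mulVec] at h
  have h1 := mulVec_eq_zero_of_mul_eq_one (mul_eq_one_of_symp (hΨ.symp_zero hsa hx ht)) h
  have h2 : -symp m * symp m = 1 := by rw [neg_mul, symp_mul_symp, neg_neg]
  exact mulVec_eq_zero_of_mul_eq_one conjTranspose_T_mul (mulVec_eq_zero_of_mul_eq_one h2 h1)

end Canonical

/-! ### A growth argument on the half-line -/

section RealAnalysis

theorem tendsto_atTop_of_le_deriv {h h' : ℝ → ℝ} {a : ℝ} (ha : 0 < a)
    (hd : ∀ x, 0 ≤ x → HasDerivWithinAt h (h' x) (Ici 0) x)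
    (hh : ∀ᶠ x in atTop, a ≤ h' x) : Tendsto h atTop atTop := by
  obtain ⟨x₀, hx₀⟩ := eventually_atTop.1 (hh.and (eventually_ge_atTop 0))
  have h0 : 0 ≤ x₀ := (hx₀ x₀ le_rfl).2
  have hd' : ∀ x ∈ Ici x₀, HasDerivWithinAt (fun y => h y - a * y) (h' x - a) (Ici x₀) x := by
    intro x hx
    have := ((hd x (h0.trans hx)).mono (Ici_subset_Ici.2 h0)).sub
      ((hasDerivWithinAt_id x (Ici x₀)).const_mul a)
    exact this.congr_deriv (by simp)
  have hm : MonotoneOn (fun y => h y - a * y) (Ici x₀) :=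
    monotoneOn_of_hasDerivWithinAt_nonneg (convex_Ici x₀)
      (fun x hx => (hd' x hx).continuousWithinAt)
      (fun x hx => (hd' x (interior_subset hx)).mono interior_subset)
      (fun x hx => sub_nonneg.2 (hx₀ x (interior_subset hx)).1)
  have h1 : Tendsto (fun x => a * x + (h x₀ - a * x₀)) atTop atTop :=
    tendsto_atTop_add_const_right _ _ (tendsto_id.const_mul_atTop ha)
  refine tendsto_atTop_mono' _ ?_ h1
  filter_upwards [eventually_ge_atTop x₀] with x hx
  have : h x₀ - a * x₀ ≤ h x - a * x := hm self_mem_Ici hx hx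
  linarith

/-- The limit point alternative, in terms of the energy `k`, the density `f` and its derivative
`r`. -/
theorem energy_eq_zero_of_bddBelow {k f r ρ : ℝ → ℝ} {b c B : ℝ} (hb : 0 < b)
    (hk : ∀ x, 0 ≤ x → HasDerivWithinAt k (-b * f x) (Ici 0) x)
    (hf : ∀ x, 0 ≤ x → HasDerivWithinAt f (r x) (Ici 0) x)
    (hr : ∀ x, 0 ≤ x → HasDerivWithinAt r (ρ x) (Ici 0) x)
    (hρ : ∀ x, 0 ≤ x → -2 * k x - c * f x ≤ ρ x) (hf0 : ∀ x, 0 ≤ x → 0 ≤ f x)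
    (hk0 : k 0 = 0) (hB : ∀ x, 0 ≤ x → -B ≤ k x) : ∀ x, 0 ≤ x → k x = 0 := by
  have hanti : AntitoneOn k (Ici 0) :=
    antitoneOn_of_hasDerivWithinAt_nonpos (convex_Ici 0) (fun x hx => (hk x hx).continuousWithinAt)
      (fun x hx => (hk x (interior_subset hx)).mono interior_subset)
      (fun x hx => by
        have := mul_nonneg hb.le (hf0 x (interior_subset hx))
        linarith)
  intro x₀ hx₀
  by_contra hne
  have hlt : k x₀ < 0 := lt_of_le_of_ne (hk0 ▸ hanti self_mem_Ici hx₀ hx₀) hne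
  have hB0 : 0 ≤ B := by linarith [hB x₀ hx₀]
  -- Subtracting (c/b)k cancels the term -cf in the lower bound for r', which leaves -2k ≥ -2k(x₀) >
  -- 0. As k is bounded, r, then f, then -k tend to infinity, a contradiction.
  have h1 : Tendsto (fun x => r x - c / b * k x) atTop atTop := by
    refine tendsto_atTop_of_le_deriv (a := -2 * k x₀) (by linarith)
      (fun x hx => (hr x hx).sub ((hk x hx).const_mul (c / b))) ?_
    filter_upwards [eventually_ge_atTop x₀] with x hx
    have e1 := hρ x (hx₀.trans hx)
    have e2 : k x ≤ k x₀ := hanti hx₀ (hx₀.trans hx : (0 : ℝ) ≤ x) hx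
    have e3 : c / b * (-b * f x) = -(c * f x) := by field_simp
    linarith
  have h2 : Tendsto f atTop atTop := by
    refine tendsto_atTop_of_le_deriv one_pos hf ?_
    filter_upwards [h1.eventually_ge_atTop (1 + |c / b| * B), eventually_ge_atTop 0] with x hx hx0
    have e1 : k x ≤ 0 := hk0 ▸ hanti self_mem_Ici hx0 hx0
    have e2 : |c / b * k x| ≤ |c / b| * B := by
      rw [abs_mul, abs_of_nonpos e1]
      exact mul_le_mul_of_nonneg_left (by linarith [hB x hx0]) (abs_nonneg _)
    linarith [neg_abs_le (c / b * k x)]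
  have h3 : Tendsto (fun x => -k x) atTop atTop := by
    refine tendsto_atTop_of_le_deriv hb (fun x hx => (hk x hx).neg) ?_
    filter_upwards [h2.eventually_ge_atTop 1] with x hx
    nlinarith
  obtain ⟨x, hx, hx0⟩ := ((h3.eventually_gt_atTop B).and (eventually_ge_atTop 0)).exists
  linarith [hB x hx0]

end RealAnalysis

/-! ### Estimates for block quadratic forms -/

section BlockForms

variable {m : ℕ}

theorem re_star_dotProduct_self {n : Type*} [Fintype n] (v : n → ℂ) :
    (star v ⬝ᵥ v).re = ∑ i, ‖v i‖ ^ 2 := by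
  simp only [dotProduct, Pi.star_apply, Complex.re_sum]
  refine Finset.sum_congr rfl fun i _ => ?_
  rw [Complex.star_def, ← Complex.normSq_eq_conj_mul_self, Complex.ofReal_re,
    Complex.normSq_eq_norm_sq]

theorem qf_fromBlocks (A B C D : Mat m) (w : Fin m ⊕ Fin m → ℂ) :
    qf (fromBlocks A B C D) w =
      (star (w ∘ Sum.inl) ⬝ᵥ (A *ᵥ (w ∘ Sum.inl) + B *ᵥ (w ∘ Sum.inr))).re +
        (star (w ∘ Sum.inr) ⬝ᵥ (C *ᵥ (w ∘ Sum.inl) + D *ᵥ (w ∘ Sum.inr))).re := by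
  rw [qf, fromBlocks_mulVec, dotProduct, Fintype.sum_sum_type, Complex.add_re]
  rfl

theorem qf_proj₁ (w : Fin m ⊕ Fin m → ℂ) : qf (proj₁ m) w = ∑ i, ‖w (Sum.inl i)‖ ^ 2 := by
  rw [proj₁, qf_fromBlocks]
  simp only [one_mulVec, zero_mulVec, add_zero, dotProduct_zero, Complex.zero_re]
  exact re_star_dotProduct_self _

theorem qf_proj₂ (w : Fin m ⊕ Fin m → ℂ) : qf (proj₂ m) w = ∑ i, ‖w (Sum.inr i)‖ ^ 2 := by
  rw [proj₂, qf_fromBlocks]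
  simp only [one_mulVec, zero_mulVec, add_zero, zero_add, dotProduct_zero, Complex.zero_re]
  exact re_star_dotProduct_self _

theorem qf_proj₁_nonneg (w : Fin m ⊕ Fin m → ℂ) : 0 ≤ qf (proj₁ m) w := by
  rw [qf_proj₁]; positivity

theorem qf_proj₂_nonneg (w : Fin m ⊕ Fin m → ℂ) : 0 ≤ qf (proj₂ m) w := by
  rw [qf_proj₂]; positivity

theorem eq_zero_of_qf_proj {w : Fin m ⊕ Fin m → ℂ} (h1 : qf (proj₁ m) w = 0)
    (h2 : qf (proj₂ m) w = 0) : w = 0 := by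
  rw [qf_proj₁, Finset.sum_eq_zero_iff_of_nonneg (fun i _ => by positivity)] at h1
  rw [qf_proj₂, Finset.sum_eq_zero_iff_of_nonneg (fun i _ => by positivity)] at h2
  ext i
  rcases i with i | i
  · simpa using h1 i (Finset.mem_univ i)
  · simpa using h2 i (Finset.mem_univ i)

/-- Expand |i w₁ + w₂|² ≥ 0. -/
theorem neg_qf_sympForm_sub_le (w : Fin m ⊕ Fin m → ℂ) :
    -qf (sympForm m) w - qf (proj₁ m) w ≤ qf (proj₂ m) w := by
  have h := qf_proj₁_nonneg
    ((fromBlocks (Complex.I • (1 : Mat m)) 1 0 0 : Mat2 m) *ᵥ w)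
  have e : (fromBlocks (Complex.I • (1 : Mat m)) 1 0 0 : Mat2 m)ᴴ * proj₁ m *
      fromBlocks (Complex.I • (1 : Mat m)) 1 0 0 = sympForm m + proj₁ m + proj₂ m := by
    rw [sympForm, symp, proj₁, proj₂, fromBlocks_smul, fromBlocks_add, fromBlocks_add,
      fromBlocks_conjTranspose, fromBlocks_multiply, fromBlocks_multiply]
    simp [smul_smul]
  rw [qf_mulVec, e, qf_add_left, qf_add_left] at h
  linarith

theorem abs_qf_diag_le {a : Mat m} {C : ℝ} (ha : ∀ i j, ‖a i j‖ ≤ C)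
    (w : Fin m ⊕ Fin m → ℂ) : |qf (fromBlocks a 0 0 0) w| ≤ C * m * qf (proj₁ m) w := by
  rw [qf_fromBlocks, qf_proj₁]
  simp only [zero_mulVec, add_zero, dotProduct_zero, Complex.zero_re]
  refine (Complex.abs_re_le_norm _).trans ?_
  simp only [dotProduct, mulVec, Pi.star_apply, Function.comp_apply]
  set y : Fin m → ℂ := fun i => w (Sum.inl i)
  have h1 : ∀ i j, ‖star (y i) * (a i j * y j)‖ ≤ C * ((‖y i‖ ^ 2 + ‖y j‖ ^ 2) / 2) := fun i j => by
    have hC : 0 ≤ C := (norm_nonneg _).trans (ha i j)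
    rw [norm_mul, norm_mul, norm_star]
    calc ‖y i‖ * (‖a i j‖ * ‖y j‖) = ‖a i j‖ * (‖y i‖ * ‖y j‖) := by ring
      _ ≤ C * ((‖y i‖ ^ 2 + ‖y j‖ ^ 2) / 2) := by
        refine mul_le_mul (ha i j) ?_ (by positivity) hC
        nlinarith [sq_nonneg (‖y i‖ - ‖y j‖)]
  calc ‖∑ i, star (y i) * ∑ j, a i j * y j‖
      ≤ ∑ i, ∑ j, C * ((‖y i‖ ^ 2 + ‖y j‖ ^ 2) / 2) := by
        refine (norm_sum_le _ _).trans (Finset.sum_le_sum fun i _ => ?_)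
        rw [Finset.mul_sum]
        exact (norm_sum_le _ _).trans (Finset.sum_le_sum fun j _ => h1 i j)
    _ = C * m * ∑ i, ‖y i‖ ^ 2 := by
        simp only [← Finset.mul_sum, ← Finset.sum_div, Finset.sum_add_distrib, Finset.sum_const,
          Finset.card_univ, Fintype.card_fin, nsmul_eq_mul]
        ring

theorem qf_J (w : Fin m ⊕ Fin m → ℂ) :
    qf (J m) w = 2 * (star (w ∘ Sum.inl) ⬝ᵥ (w ∘ Sum.inr)).re := by
  rw [J, qf_fromBlocks]
  simp only [zero_mulVec, one_mulVec, zero_add, add_zero]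
  have : star (w ∘ Sum.inr) ⬝ᵥ (w ∘ Sum.inl) = star (star (w ∘ Sum.inl) ⬝ᵥ (w ∘ Sum.inr)) := by
    rw [star_dotProduct, dotProduct_comm]
  rw [this]
  simp
  ring

theorem qf_sympForm_T_mul_J (w : Fin m ⊕ Fin m → ℂ) :
    qf (sympForm m) ((T m * J m) *ᵥ w) = qf (J m) w := by
  rw [qf_mulVec]
  congr 1
  calc (T m * J m)ᴴ * sympForm m * (T m * J m)
      = (-Complex.I) • (J m * ((T m)ᴴ * symp m * T m) * J m) := by
        rw [conjTranspose_mul, conjTranspose_J, sympForm, mul_smul_comm, smul_mul_assoc]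
        simp only [mul_assoc]
    _ = J m := by
        rw [conjTranspose_T_mul_symp_mul, mul_smul_comm, smul_mul_assoc, smul_smul, J_mul_J,
          one_mul]
        simp

end BlockForms

/-! ### Energy identities and the limit point case -/

section Energy

variable {m : ℕ} {tmax : EReal} {u : ℝ → ℝ → Mat m} {Ψ : ℝ → ℝ → ℂ → Mat2 m}

theorem G_proj₁ (hsa : IsSelfAdjointOnStrip tmax u) {x t : ℝ} (hx : 0 ≤ x)
    (ht : t ∈ timeSet tmax) (z : ℂ) :
    (G u x t z)ᴴ * proj₁ m + proj₁ m * G u x t z = J m := by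
  rw [conjTranspose_G hsa hx ht, G, proj₁, J, fromBlocks_multiply, fromBlocks_multiply,
    fromBlocks_add]
  simp

theorem G_J (hsa : IsSelfAdjointOnStrip tmax u) {x t : ℝ} (hx : 0 ≤ x)
    (ht : t ∈ timeSet tmax) (z : ℂ) :
    (G u x t z)ᴴ * J m + J m * G u x t z = ((2 : ℝ) : ℂ) • proj₂ m +
      ((2 : ℝ) : ℂ) • fromBlocks (u x t) 0 0 0 + ((-2 * z.re : ℝ) : ℂ) • proj₁ m := by
  rw [conjTranspose_G hsa hx ht, G, proj₁, proj₂, J, fromBlocks_multiply, fromBlocks_multiply,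
    fromBlocks_add, fromBlocks_smul, fromBlocks_smul, fromBlocks_smul, fromBlocks_add,
    fromBlocks_add]
  congr 1
  · simp
    match_scalars <;> (apply Complex.ext <;> simp <;> ring)
  · simp
  · simp
  · simp
    module

variable (hΨ : IsXFundamental tmax u Ψ) (hsa : IsSelfAdjointOnStrip tmax u) {t : ℝ}
  (ht : t ∈ timeSet tmax) (z : ℂ) (w : Fin m ⊕ Fin m → ℂ)

include hΨ hsa ht

theorem hasDerivWithinAt_energy {x : ℝ} (hx : 0 ≤ x) :
    HasDerivWithinAt (fun x => qf (sympForm m) (Ψ x t z *ᵥ w))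
      (-(2 * z.im) * qf (proj₁ m) (Ψ x t z *ᵥ w)) (Ici 0) x := by
  have h := hasDerivWithinAt_qf (hΨ.hasDerivWithinAt hx ht z) (sympForm m) w
  rw [G_sympForm hsa hx ht, qf_smul_left] at h
  exact h.congr_deriv (by ring)

theorem hasDerivWithinAt_density {x : ℝ} (hx : 0 ≤ x) :
    HasDerivWithinAt (fun x => qf (proj₁ m) (Ψ x t z *ᵥ w))
      (qf (J m) (Ψ x t z *ᵥ w)) (Ici 0) x := by
  have h := hasDerivWithinAt_qf (hΨ.hasDerivWithinAt hx ht z) (proj₁ m) w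
  rwa [G_proj₁ hsa hx ht] at h

theorem hasDerivWithinAt_density_deriv {x : ℝ} (hx : 0 ≤ x) :
    HasDerivWithinAt (fun x => qf (J m) (Ψ x t z *ᵥ w))
      (2 * qf (proj₂ m) (Ψ x t z *ᵥ w) + 2 * qf (fromBlocks (u x t) 0 0 0) (Ψ x t z *ᵥ w)
        - 2 * z.re * qf (proj₁ m) (Ψ x t z *ᵥ w)) (Ici 0) x := by
  have h := hasDerivWithinAt_qf (hΨ.hasDerivWithinAt hx ht z) (J m) w
  rw [G_J hsa hx ht, qf_add_left, qf_add_left, qf_smul_left, qf_smul_left, qf_smul_left] at h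
  exact h.congr_deriv (by ring)

theorem antitoneOn_energy (hz : 0 < z.im) :
    AntitoneOn (fun x => qf (sympForm m) (Ψ x t z *ᵥ w)) (Ici 0) :=
  antitoneOn_of_hasDerivWithinAt_nonpos (convex_Ici 0)
    (fun _ hx => (hasDerivWithinAt_energy hΨ hsa ht z w hx).continuousWithinAt)
    (fun _ hx => (hasDerivWithinAt_energy hΨ hsa ht z w (interior_subset hx)).mono interior_subset)
    (fun x _ => by
      have := mul_nonneg hz.le (qf_proj₁_nonneg (Ψ x t z *ᵥ w))
      linarith)

/-- Constant energy forces the density |w₁|² of the solution to vanish on [0, l], and with it its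
first two derivatives. At x = 0, where Ψ = I, the second derivative reduces to 2|w₂|², since the
term with u is dominated by the density. -/
theorem eq_zero_of_energy_const (hz : 0 < z.im) {l c : ℝ} (hl : 0 < l)
    (h : ∀ x ∈ Icc 0 l, qf (sympForm m) (Ψ x t z *ᵥ w) = c) : w = 0 := by
  have hder : ∀ {f : ℝ → ℝ} {f' c x : ℝ}, x ∈ Icc 0 l → HasDerivWithinAt f f' (Ici 0) x →
      (∀ y ∈ Icc 0 l, f y = c) → f' = 0 := fun {f f' c x} hx hf hc => by
    have h1 := (hf.mono Icc_subset_Ici_self).congr (f₁ := fun _ => c)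
      (fun y hy => (hc y hy).symm) (hc x hx).symm
    exact (uniqueDiffOn_Icc hl x hx).eq_deriv _ h1 (hasDerivWithinAt_const _ _ _)
  have h1 : ∀ x ∈ Icc 0 l, qf (proj₁ m) (Ψ x t z *ᵥ w) = 0 := fun x hx => by
    have := hder hx (hasDerivWithinAt_energy hΨ hsa ht z w hx.1) h
    simpa [hz.ne'] using this
  have h2 : ∀ x ∈ Icc 0 l, qf (J m) (Ψ x t z *ᵥ w) = 0 := fun x hx =>
    hder hx (hasDerivWithinAt_density hΨ hsa ht z w hx.1) h1
  have h0 : (0 : ℝ) ∈ Icc 0 l := ⟨le_rfl, hl.le⟩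
  have h3 := hder h0 (hasDerivWithinAt_density_deriv hΨ hsa ht z w le_rfl) h2
  have h4 := h1 0 h0
  rw [(hΨ t ht z).1, one_mulVec] at h3 h4
  obtain ⟨C, hC⟩ : ∃ C : ℝ, ∀ i j, ‖u 0 t i j‖ ≤ C :=
    ⟨∑ i, ∑ j, ‖u 0 t i j‖, fun i j =>
      (Finset.single_le_sum (f := fun j => ‖u 0 t i j‖) (fun _ _ => norm_nonneg _)
        (Finset.mem_univ j)).trans (Finset.single_le_sum (f := fun i => ∑ j, ‖u 0 t i j‖)
        (fun _ _ => Finset.sum_nonneg fun _ _ => norm_nonneg _) (Finset.mem_univ i))⟩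
  have h5 := abs_qf_diag_le hC w
  rw [h4, mul_zero, abs_nonpos_iff] at h5
  rw [h4, h5] at h3
  exact eq_zero_of_qf_proj h4 (by linarith)

theorem energy_lt (hz : 0 < z.im) {l : ℝ} (hl : 0 < l) (hw : w ≠ 0) :
    qf (sympForm m) (Ψ l t z *ᵥ w) < qf (sympForm m) w := by
  have ha := antitoneOn_energy hΨ hsa ht z w hz
  have h0 : qf (sympForm m) (Ψ 0 t z *ᵥ w) = qf (sympForm m) w := by
    rw [(hΨ t ht z).1, one_mulVec]
  have hle : qf (sympForm m) (Ψ l t z *ᵥ w) ≤ qf (sympForm m) (Ψ 0 t z *ᵥ w) :=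
    ha self_mem_Ici hl.le hl.le
  refine lt_of_le_of_ne (hle.trans_eq h0) fun he => hw ?_
  refine eq_zero_of_energy_const hΨ hsa ht z w hz hl (c := qf (sympForm m) w) fun x hx => ?_
  have e1 : qf (sympForm m) (Ψ x t z *ᵥ w) ≤ qf (sympForm m) (Ψ 0 t z *ᵥ w) :=
    ha self_mem_Ici hx.1 hx.1
  have e2 : qf (sympForm m) (Ψ l t z *ᵥ w) ≤ qf (sympForm m) (Ψ x t z *ᵥ w) :=
    ha hx.1 hl.le hx.2
  linarith

/-- For a bounded potential the system is in the limit point case at infinity. -/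
theorem eq_zero_of_energy_bddBelow (hbdd : IsBoundedOnStrip tmax u) (hz : 0 < z.im)
    (h0 : qf (sympForm m) w = 0) {B : ℝ}
    (hB : ∀ x, 0 ≤ x → -B ≤ qf (sympForm m) (Ψ x t z *ᵥ w)) : w = 0 := by
  obtain ⟨C, hC⟩ := hbdd
  refine eq_zero_of_energy_const hΨ hsa ht z w hz one_pos (c := 0) fun x hx => ?_
  -- The second derivative of the density is 2|w₂|² + 2w₁*uw₁ - 2 Re z |w₁|². The bound |w₂|² ≥ -k -
  -- |w₁|², with k the energy, and |w₁*uw₁| ≤ Cm|w₁|² give this value of `c`.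
  refine energy_eq_zero_of_bddBelow (b := 2 * z.im) (c := 2 + 2 * (C * m) + 2 * z.re) (B := B)
    (by linarith)
    (fun x hx => hasDerivWithinAt_energy hΨ hsa ht z w hx)
    (fun x hx => hasDerivWithinAt_density hΨ hsa ht z w hx)
    (fun x hx => hasDerivWithinAt_density_deriv hΨ hsa ht z w hx)
    (fun x hx => ?_) (fun x _ => qf_proj₁_nonneg _)
    (by rw [(hΨ t ht z).1, one_mulVec, h0]) hB x hx.1
  have h1 := neg_qf_sympForm_sub_le (Ψ x t z *ᵥ w)
  have h2 := neg_le_of_abs_le (abs_qf_diag_le (hC x t hx ht) (Ψ x t z *ᵥ w))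
  linarith

end Energy

/-! ### Nested Weyl disks -/

section WeylDisks

variable {m : ℕ}

/-- The properties of a decreasing family of Hermitian forms that give rise to nested Weyl disks
shrinking to a point. -/
structure IsWeylFamily (E : ℝ → Mat2 m) : Prop where
  antitone : ∀ w, AntitoneOn (fun l => qf (E l) w) (Ici 0)
  zero : ∀ w, qf (E 0) w = qf (J m) w
  lt : ∀ l, 0 < l → ∀ w, w ≠ 0 → qf (E l) w < qf (J m) w
  limitPoint : ∀ w, qf (J m) w = 0 → (∃ B : ℝ, ∀ l, 0 ≤ l → -B ≤ qf (E l) w) → w = 0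

/-- The vector `[N v; v]`. -/
def graphVec (N : Mat m) (v : Fin m → ℂ) : Fin m ⊕ Fin m → ℂ := Sum.elim (N *ᵥ v) v

/-- The Weyl disk of a quadratic form. -/
def weylDisk (B : Mat2 m) : Set (Mat m) := {N | ∀ v, 0 ≤ qf B (graphVec N v)}

theorem qf_J_elim (a b : Fin m → ℂ) : qf (J m) (Sum.elim a b) = 2 * (star a ⬝ᵥ b).re := qf_J _

theorem isClosed_weylDisk (B : Mat2 m) : IsClosed (weylDisk B) := by
  rw [weylDisk, ofPred_forall]
  refine isClosed_iInter fun v => isClosed_le continuous_const ((continuous_qf B).comp ?_)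
  refine continuous_pi fun i => ?_
  rcases i with i | i
  · exact (continuous_apply i).comp (continuous_id.matrix_mulVec continuous_const)
  · exact continuous_const

/-- The gap attains a positive minimum on the compact unit sphere and is homogeneous of degree two.
-/
theorem exists_pos_mul_sq_norm_le {n : Type*} [Fintype n] {A B : Matrix n n ℂ}
    (h : ∀ w, w ≠ 0 → qf A w < qf B w) : ∃ c > 0, ∀ w, c * ‖w‖ ^ 2 ≤ qf B w - qf A w := by
  obtain ⟨c, hc, hle⟩ := (isCompact_sphere (0 : n → ℂ) 1).exists_forall_le'
    (f := fun w => qf B w - qf A w) ((continuous_qf B).sub (continuous_qf A)).continuousOn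
    (a := 0) (fun w hw => sub_pos.2 (h w (ne_zero_of_mem_unit_sphere ⟨w, hw⟩)))
  refine ⟨c, hc, fun w => ?_⟩
  rcases eq_or_ne w 0 with rfl | hw
  · simp [qf]
  have hn : ‖w‖ ≠ 0 := norm_ne_zero_iff.2 hw
  have h1 := hle (((‖w‖⁻¹ : ℝ) : ℂ) • w) (by simp [norm_smul, hn])
  rw [qf_smul, qf_smul, ← mul_sub] at h1
  have h2 := mul_le_mul_of_nonneg_right h1 (sq_nonneg ‖w‖)
  calc c * ‖w‖ ^ 2 ≤ _ := h2
    _ = qf B w - qf A w := by field_simp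

namespace IsWeylFamily

variable {E : ℝ → Mat2 m}

/-- For w = [N e; e] with e a basis vector, the gap gives c‖w‖² ≤ qf J w, while the right side is
only 2 Re of one entry of N, at most 2‖w‖. Hence the entries of N are bounded by 2/c. -/
theorem isCompact_weylDisk (hE : IsWeylFamily E) {l : ℝ} (hl : 0 < l) :
    IsCompact (weylDisk (E l)) := by
  obtain ⟨c, hc, hle⟩ := exists_pos_mul_sq_norm_le (hE.lt l hl)
  refine IsCompact.of_isClosed_subset (isCompact_univ_pi fun _ : Fin m => isCompact_univ_pi
    fun _ : Fin m => isCompact_closedBall (0 : ℂ) (2 / c)) (isClosed_weylDisk _) ?_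
  intro N hN i _ k _
  set w := graphVec N (Pi.single k 1)
  have hik : ∀ i, w (Sum.inl i) = N i k := fun i => by simp [w, graphVec]
  have hw1 : 1 ≤ ‖w‖ := by
    have := norm_le_pi_norm w (Sum.inr k)
    simpa [w, graphVec] using this
  have hNw : ∀ i, ‖N i k‖ ≤ ‖w‖ := fun i => hik i ▸ norm_le_pi_norm w (Sum.inl i)
  have h1 : qf (J m) w ≤ 2 * ‖w‖ := by
    rw [show qf (J m) w = 2 * (N k k).re by simp [w, graphVec, qf_J_elim]]
    linarith [Complex.re_le_norm (N k k), hNw k]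
  have h2 := hle w
  have h3 : 0 ≤ qf (E l) w := hN _
  rw [mem_closedBall_zero_iff]
  refine (hNw i).trans ?_
  rw [le_div_iff₀ hc]
  nlinarith

theorem weylDisk_antitone (hE : IsWeylFamily E) {l l' : ℝ} (hl : 0 ≤ l) (hll' : l ≤ l') :
    weylDisk (E l') ⊆ weylDisk (E l) :=
  fun _ hN v => (hN v).trans (hE.antitone _ hl (hl.trans hll' : (0 : ℝ) ≤ l') hll')

/-- The difference of [N₁v; v] and [N₂v; v] has zero second component, hence zero J-form. By the
parallelogram identity its form stays bounded below, and the limit point property forces it to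
vanish. -/
theorem eq_of_mem_weylDisk (hE : IsWeylFamily E) {N₁ N₂ : Mat m}
    (h₁ : ∀ l, 0 < l → N₁ ∈ weylDisk (E l)) (h₂ : ∀ l, 0 < l → N₂ ∈ weylDisk (E l)) :
    N₁ = N₂ := by
  refine sub_eq_zero.1 (Matrix.ext_of_mulVec_single fun k => ?_)
  set v : Fin m → ℂ := Pi.single k 1
  have hw : graphVec N₁ v - graphVec N₂ v = Sum.elim ((N₁ - N₂) *ᵥ v) 0 := by
    ext i
    rcases i with i | i <;> simp [graphVec, sub_mulVec]
  have h0 : graphVec N₁ v - graphVec N₂ v = 0 := by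
    refine hE.limitPoint _ (by rw [hw, qf_J_elim]; simp)
      ⟨qf (J m) (graphVec N₁ v + graphVec N₂ v), fun l hl => ?_⟩
    -- The bound is also needed at l = 0, where membership is not assumed; nestedness supplies it
    -- from l + 1.
    have hl1 : 0 < l + 1 := by linarith
    have e1 := qf_parallelogram (E l) (graphVec N₁ v) (graphVec N₂ v)
    have e2 : qf (E l) (graphVec N₁ v + graphVec N₂ v) ≤ _ :=
      hE.antitone _ self_mem_Ici hl hl
    have e3 := hE.weylDisk_antitone hl (by linarith) (h₁ _ hl1) v
    have e4 := hE.weylDisk_antitone hl (by linarith) (h₂ _ hl1) v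
    have e5 := hE.zero (graphVec N₁ v + graphVec N₂ v)
    simp only at e2
    linarith
  rw [zero_mulVec]
  funext i
  have := congrFun (hw.symm.trans h0) (Sum.inl i)
  simpa using this

/-- The Weyl disks shrink to a point. -/
theorem exists_weylPoint (hE : IsWeylFamily E) (hne : ∀ l, 0 < l → (weylDisk (E l)).Nonempty) :
    ∃ N : Mat m, (∀ l, 0 < l → N ∈ weylDisk (E l)) ∧
      ∀ f : ℝ → Mat m, (∀ l, 0 < l → f l ∈ weylDisk (E l)) → Tendsto f atTop (𝓝 N) := by
  have hpos : ∀ n : ℕ, (0 : ℝ) < n + 1 := fun n => by positivity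
  have hanti : Antitone fun n : ℕ => weylDisk (E (n + 1)) := fun a b hab =>
    hE.weylDisk_antitone (hpos a).le (by gcongr)
  obtain ⟨N, hN⟩ := IsCompact.nonempty_iInter_of_sequence_nonempty_isCompact_isClosed
    (fun n : ℕ => weylDisk (E (n + 1))) (fun n => hanti n.le_succ) (fun n => hne _ (hpos n))
    (hE.isCompact_weylDisk (hpos 0)) (fun n => isClosed_weylDisk _)
  have hmem : ∀ N ∈ ⋂ n : ℕ, weylDisk (E (n + 1)), ∀ l, 0 < l → N ∈ weylDisk (E l) :=
    fun N hN l hl => by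
      obtain ⟨n, hn⟩ := exists_nat_ge l
      exact hE.weylDisk_antitone hl.le (by linarith) (mem_iInter.1 hN n)
  refine ⟨N, hmem N hN, fun f hf => ?_⟩
  intro U hU
  -- The decreasing compact disks meet only in N, so one of them lies inside the given neighbourhood
  -- of N.
  obtain ⟨n, hn⟩ := exists_subset_nhds_of_isCompact hanti.directed_ge
    (fun n => hE.isCompact_weylDisk (hpos n)) (U := U) fun N' hN' =>
      hE.eq_of_mem_weylDisk (hmem N hN) (hmem N' hN') ▸ hU
  refine mem_map.2 ?_
  filter_upwards [eventually_ge_atTop ((n : ℝ) + 1)] with l hl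
  exact hn (hE.weylDisk_antitone (hpos n).le hl (hf l ((hpos n).trans_le hl)))

end IsWeylFamily

end WeylDisks

/-! ### Linear fractional transformations of J-pairs -/

section FractionalTransformation

variable {m : ℕ}

theorem mulVec_elim (A : Mat2 m) (P Q : Mat m) (v : Fin m → ℂ) :
    A *ᵥ Sum.elim (P *ᵥ v) (Q *ᵥ v) =
      Sum.elim ((A.toBlocks₁₁ * P + A.toBlocks₁₂ * Q) *ᵥ v) (lftDen A P Q *ᵥ v) := by
  conv_lhs => rw [← fromBlocks_toBlocks A]
  rw [fromBlocks_mulVec, Sum.elim_comp_inl, Sum.elim_comp_inr, mulVec_mulVec, mulVec_mulVec,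
    mulVec_mulVec, mulVec_mulVec, ← add_mulVec, ← add_mulVec, lftDen]

theorem isUnit_of_mulVec_eq_zero {A : Mat m} (h : ∀ v, A *ᵥ v = 0 → v = 0) : IsUnit A := by
  rw [← mulVec_injective_iff_isUnit]
  intro v w hvw
  refine sub_eq_zero.1 (h _ ?_)
  rw [mulVec_sub, sub_eq_zero]
  exact hvw

theorem graphVec_mul_inv {A B : Mat m} (hB : IsUnit B) (v : Fin m → ℂ) :
    graphVec (A * B⁻¹) v = Sum.elim (A *ᵥ (B⁻¹ *ᵥ v)) (B *ᵥ (B⁻¹ *ᵥ v)) := by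
  rw [graphVec, mulVec_mulVec, mulVec_mulVec,
    mul_nonsing_inv _ ((isUnit_iff_isUnit_det _).1 hB), one_mulVec]

namespace IsJPair

variable {P Q : Mat m}

theorem qf_J_nonneg (h : IsJPair P Q) (v : Fin m → ℂ) :
    0 ≤ qf (J m) (Sum.elim (P *ᵥ v) (Q *ᵥ v)) := by
  have h1 := (Complex.le_def.1 (h.2.dotProduct_mulVec_nonneg v)).1
  have h2 : star v ⬝ᵥ (Pᴴ * Q + Qᴴ * P) *ᵥ v =
      star (P *ᵥ v) ⬝ᵥ (Q *ᵥ v) + star (star (P *ᵥ v) ⬝ᵥ (Q *ᵥ v)) := by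
    rw [← star_dotProduct, add_mulVec, dotProduct_add, star_mulVec, star_mulVec,
      ← mulVec_mulVec, ← mulVec_mulVec, ← dotProduct_mulVec, ← dotProduct_mulVec]
  rw [h2] at h1
  rw [qf_J_elim]
  simp at h1
  linarith

theorem eq_zero (h : IsJPair P Q) {v : Fin m → ℂ}
    (hv : (Sum.elim (P *ᵥ v) (Q *ᵥ v) : Fin m ⊕ Fin m → ℂ) = 0) : v = 0 := by
  have hP : P *ᵥ v = 0 := funext fun i => congrFun hv (Sum.inl i)
  have hQ : Q *ᵥ v = 0 := funext fun i => congrFun hv (Sum.inr i)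
  by_contra hne
  have h1 := h.1.dotProduct_mulVec_pos hne
  rw [add_mulVec, ← mulVec_mulVec, ← mulVec_mulVec, hP, hQ] at h1
  simp at h1

theorem one_one : IsJPair (1 : Mat m) 1 := by
  constructor
  · simpa using PosDef.one.add_posSemidef PosSemidef.one
  · simpa using PosSemidef.one.add PosSemidef.one

end IsJPair

/-- A strict inequality of forms makes a linear fractional transformation well defined, with values
in the Weyl disk. -/
theorem isUnit_of_qf_nonneg {B : Mat2 m} (hlt : ∀ w, w ≠ 0 → qf B w < qf (J m) w)
    {A D : Mat m} (hpos : ∀ v, 0 ≤ qf B (Sum.elim (A *ᵥ v) (D *ᵥ v)))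
    (hinj : ∀ v, (Sum.elim (A *ᵥ v) (D *ᵥ v) : Fin m ⊕ Fin m → ℂ) = 0 → v = 0) :
    IsUnit D := by
  refine isUnit_of_mulVec_eq_zero fun v hv => hinj v ?_
  -- If Dv = 0, then [Av; 0] has zero J-form; were it nonzero, its B-form would be negative.
  by_contra hne
  have h1 := (hpos v).trans_lt (hlt _ hne)
  rw [hv, qf_J_elim] at h1
  simp at h1

theorem mul_inv_mem_weylDisk {B : Mat2 m} {A D : Mat m} (hD : IsUnit D)
    (hpos : ∀ v, 0 ≤ qf B (Sum.elim (A *ᵥ v) (D *ᵥ v))) : A * D⁻¹ ∈ weylDisk B := fun v => by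
  rw [graphVec_mul_inv hD]
  exact hpos _

end FractionalTransformation

/-! ### Existence and characterization of the Weyl function -/

section WeylFunction

variable {m : ℕ} {tmax : EReal} {u : ℝ → ℝ → Mat m} {Ψ : ℝ → ℝ → ℂ → Mat2 m}

/-- The Hermitian form whose Weyl disk is the set of values of the Weyl functions of the
interval `(0, l)`. -/
noncomputable def weylForm (Ψ : ℝ → ℝ → ℂ → Mat2 m) (t : ℝ) (z : ℂ) (l : ℝ) : Mat2 m :=
  (Ψ l t z * T m * J m)ᴴ * sympForm m * (Ψ l t z * T m * J m)

theorem qf_weylForm (Ψ : ℝ → ℝ → ℂ → Mat2 m) (t : ℝ) (z : ℂ) (l : ℝ) (w : Fin m ⊕ Fin m → ℂ) :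
    qf (weylForm Ψ t z l) w = qf (sympForm m) (Ψ l t z *ᵥ ((T m * J m) *ᵥ w)) := by
  rw [weylForm, ← qf_mulVec, mulVec_mulVec, ← mul_assoc]

variable (hΨ : IsXFundamental tmax u Ψ) (hsa : IsSelfAdjointOnStrip tmax u) {t : ℝ}
  (ht : t ∈ timeSet tmax) {z : ℂ}

include hΨ hsa ht

theorem isWeylFamily_weylForm (hz : 0 < z.im) (hbdd : IsBoundedOnStrip tmax u) :
    IsWeylFamily (weylForm Ψ t z) := by
  have hTJ : ∀ w, (T m * J m) *ᵥ w = 0 → w = 0 := fun w hw =>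
    mulVec_eq_zero_of_mul_eq_one (Y := J m * (T m)ᴴ) (by
      rw [mul_assoc, ← mul_assoc (T m)ᴴ, conjTranspose_T_mul, one_mul, J_mul_J]) hw
  refine ⟨fun w => ?_, fun w => ?_, fun l hl w hw => ?_, fun w h0 ⟨B, hB⟩ => ?_⟩
  · simp only [qf_weylForm]
    exact antitoneOn_energy hΨ hsa ht z _ hz
  · rw [qf_weylForm, (hΨ t ht z).1, one_mulVec, qf_sympForm_T_mul_J]
  · rw [qf_weylForm, ← qf_sympForm_T_mul_J]
    exact energy_lt hΨ hsa ht z _ hz hl fun h => hw (hTJ w h)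
  · simp only [qf_weylForm] at hB
    rw [← qf_sympForm_T_mul_J] at h0
    exact hTJ w (eq_zero_of_energy_bddBelow hΨ hsa ht z _ hbdd hz h0 hB)

/-- This identifies the form at l with the J-form of the pair, so property-J of the pair yields both
invertibility and membership in the disk. -/
theorem qf_weylForm_lftDen {l : ℝ} (hl : 0 ≤ l) (P Q : Mat m) (v : Fin m → ℂ) :
    qf (weylForm Ψ t z l)
      (Sum.elim (((canonicalSolution Ψ t l (star z))ᴴ.toBlocks₁₁ * P +
        (canonicalSolution Ψ t l (star z))ᴴ.toBlocks₁₂ * Q) *ᵥ v)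
        (lftDen (canonicalSolution Ψ t l (star z))ᴴ P Q *ᵥ v)) =
      qf (J m) (Sum.elim (P *ᵥ v) (Q *ᵥ v)) := by
  rw [← mulVec_elim, weylForm, ← qf_mulVec, qf_sympForm_canonicalSolution hΨ hsa hl ht]

theorem isUnit_lftDen (hz : 0 < z.im) (hbdd : IsBoundedOnStrip tmax u) {l : ℝ}
    (hl : 0 < l) {P Q : Mat m} (hPQ : IsJPair P Q) :
    IsUnit (lftDen (canonicalSolution Ψ t l (star z))ᴴ P Q) := by
  refine isUnit_of_qf_nonneg ((isWeylFamily_weylForm hΨ hsa ht hz hbdd).lt l hl)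
    (A := (canonicalSolution Ψ t l (star z))ᴴ.toBlocks₁₁ * P +
      (canonicalSolution Ψ t l (star z))ᴴ.toBlocks₁₂ * Q) (fun v => ?_) fun v hv => ?_
  · rw [qf_weylForm_lftDen hΨ hsa ht hl.le]
    exact hPQ.qf_J_nonneg v
  · rw [← mulVec_elim] at hv
    exact hPQ.eq_zero (mulVec_conjTranspose_canonicalSolution_eq_zero hΨ hsa hl.le ht z hv)

theorem exists_mem_weylDisk_lft (hz : 0 < z.im) (hbdd : IsBoundedOnStrip tmax u) {l : ℝ}
    (hl : 0 < l) {P Q : Mat m} (hPQ : IsJPair P Q) : ∃ N ∈ weylDisk (weylForm Ψ t z l),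
      lft (canonicalSolution Ψ t l (star z))ᴴ P Q = Complex.I • N := by
  refine ⟨_, mul_inv_mem_weylDisk (isUnit_lftDen hΨ hsa ht hz hbdd hl hPQ) (fun v => ?_), rfl⟩
  rw [qf_weylForm_lftDen hΨ hsa ht hl.le]
  exact hPQ.qf_J_nonneg v

theorem exists_weylPoint_weylForm (hz : 0 < z.im) (hbdd : IsBoundedOnStrip tmax u) :
    ∃ N : Mat m, (∀ l, 0 < l → N ∈ weylDisk (weylForm Ψ t z l)) ∧
      ∀ P Q : ℝ → Mat m, (∀ l, 0 < l → IsJPair (P l) (Q l)) →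
        Tendsto (fun l => lft (canonicalSolution Ψ t l (star z))ᴴ (P l) (Q l)) atTop
          (𝓝 (Complex.I • N)) := by
  obtain ⟨N, hN, hlim⟩ := (isWeylFamily_weylForm hΨ hsa ht hz hbdd).exists_weylPoint fun l hl =>
    (exists_mem_weylDisk_lft hΨ hsa ht hz hbdd hl IsJPair.one_one).imp fun _ h => h.1
  refine ⟨N, hN, fun P Q hPQ => ?_⟩
  have hex : ∀ l, ∃ N : Mat m, 0 < l → N ∈ weylDisk (weylForm Ψ t z l) ∧
      lft (canonicalSolution Ψ t l (star z))ᴴ (P l) (Q l) = Complex.I • N := fun l => by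
    by_cases hl : 0 < l
    · obtain ⟨N, h⟩ := exists_mem_weylDisk_lft hΨ hsa ht hz hbdd hl (hPQ l hl)
      exact ⟨N, fun _ => h⟩
    · exact ⟨0, fun h => absurd h hl⟩
  choose f hf using hex
  refine ((hlim f fun l hl => (hf l hl).1).const_smul Complex.I).congr' ?_
  filter_upwards [eventually_gt_atTop 0] with l hl
  exact (hf l hl).2.symm

/-- The value of a Weyl function is, up to the factor `i`, in all Weyl disks. -/
theorem IsWeylFunction.neg_I_smul_mem_weylDisk (hz : 0 < z.im) (hbdd : IsBoundedOnStrip tmax u)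
    {M : ℂ → Mat m} (hM : IsWeylFunction (fun x => hamiltonian Ψ x t) M) {l : ℝ} (hl : 0 < l) :
    (-Complex.I) • M z ∈ weylDisk (weylForm Ψ t z l) := by
  obtain ⟨W, hW, h⟩ := hM
  obtain ⟨N, hN, hlim⟩ := exists_weylPoint_weylForm hΨ hsa ht hz hbdd
  have h1 := (h z hz (fun _ => 1) (fun _ => 1) fun _ _ => IsJPair.one_one).2
  have h2 := hlim (fun _ => 1) (fun _ => 1) fun _ _ => IsJPair.one_one
  have h3 : M z = Complex.I • N := by
    refine tendsto_nhds_unique h1 (h2.congr' ?_)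
    filter_upwards [eventually_ge_atTop 0] with l hl
    rw [hW.eq_canonicalSolution hΨ hsa ht hl]
  rw [h3, smul_smul]
  simpa using hN l hl

theorem exists_isWeylFunction (hbdd : IsBoundedOnStrip tmax u) :
    ∃ M : ℂ → Mat m, IsWeylFunction (fun x => hamiltonian Ψ x t) M := by
  have hex : ∀ z : ℂ, ∃ M : Mat m, 0 < z.im → ∀ P Q : ℝ → Mat m,
      (∀ l : ℝ, 0 < l → IsJPair (P l) (Q l)) →
        Tendsto (fun l => lft (canonicalSolution Ψ t l (star z))ᴴ (P l) (Q l)) atTop (𝓝 M) :=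
    fun z => by
      by_cases hz : 0 < z.im
      · obtain ⟨N, -, h⟩ := exists_weylPoint_weylForm hΨ hsa ht hz hbdd
        exact ⟨_, fun _ => h⟩
      · exact ⟨0, fun h => absurd h hz⟩
  choose M hM using hex
  refine ⟨M, canonicalSolution Ψ t, isCanonicalFundamental_canonicalSolution hΨ hsa ht,
    fun z hz P Q hPQ => ⟨fun l hl => isUnit_lftDen hΨ hsa ht hz hbdd hl (hPQ l hl),
      hM z hz P Q hPQ⟩⟩

end WeylFunction

/-! ### Transport of the energy in time -/

section Evolution

variable {m : ℕ} {tmax : EReal} {u : ℝ → ℝ → Mat m} {Ψ V : ℝ → ℝ → ℂ → Mat2 m}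

theorem mem_nhds_halfStrip {x t t' : ℝ} (hx : 0 < x) (ht : 0 < t) (htt' : t < t')
    (ht' : t' ∈ timeSet tmax) : halfStrip tmax ∈ 𝓝 (x, t) := by
  refine prod_mem_nhds (Ici_mem_nhds hx) ?_
  exact mem_of_superset (Icc_mem_nhds ht htt') ((isInitialInterval_timeSet tmax).Icc_subset t' ht')

theorem eventually_hasDerivAt_of_strip {f : ℝ → ℝ → Mat2 m} {f₁ f₂ : ℝ → ℝ → Mat2 m} {x t t' : ℝ}
    (hx : 0 < x) (ht : 0 < t) (htt' : t < t') (ht' : t' ∈ timeSet tmax)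
    (h₁ : ∀ x t, 0 ≤ x → t ∈ timeSet tmax →
      HasDerivWithinAt (fun y => f y t) (f₁ x t) (Ici 0) x)
    (h₂ : ∀ x t, 0 ≤ x → t ∈ timeSet tmax →
      HasDerivWithinAt (fun s => f x s) (f₂ x t) (timeSet tmax) t) :
    ∀ᶠ v : ℝ × ℝ in 𝓝 (x, t), HasDerivAt (fun y => f y v.2) (f₁ v.1 v.2) v.1 ∧
      HasDerivAt (fun s => f v.1 s) (f₂ v.1 v.2) v.2 := by
  have hI := isInitialInterval_timeSet tmax
  filter_upwards [prod_mem_nhds (Ioi_mem_nhds hx) (Ioo_mem_nhds ht htt')] with v hv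
  have hv2 : v.2 ∈ timeSet tmax := hI.Icc_subset t' ht' ⟨hv.2.1.le, hv.2.2.le⟩
  exact ⟨(h₁ _ _ (le_of_lt hv.1) hv2).hasDerivAt (Ici_mem_nhds hv.1),
    (h₂ _ _ (le_of_lt hv.1) hv2).hasDerivAt
      (mem_of_superset (Icc_mem_nhds hv.2.1 hv.2.2) (hI.Icc_subset t' ht'))⟩

/-- The derivative, along a line, of a function on the half-strip with continuous partial
derivatives. -/
theorem hasDerivAt_line_of_strip {f : ℝ → ℝ → Mat2 m} {f₁ f₂ : ℝ → ℝ → Mat2 m} {x t t' c : ℝ}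
    (hx : 0 < x) (ht : 0 < t) (htt' : t < t') (ht' : t' ∈ timeSet tmax)
    (h₁ : ∀ x t, 0 ≤ x → t ∈ timeSet tmax →
      HasDerivWithinAt (fun y => f y t) (f₁ x t) (Ici 0) x)
    (h₂ : ∀ x t, 0 ≤ x → t ∈ timeSet tmax →
      HasDerivWithinAt (fun s => f x s) (f₂ x t) (timeSet tmax) t)
    (hc₁ : ContinuousOn (fun p : ℝ × ℝ => f₁ p.1 p.2) (halfStrip tmax))
    (hc₂ : ContinuousOn (fun p : ℝ × ℝ => f₂ p.1 p.2) (halfStrip tmax))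
    {γ : ℝ → ℝ} (hγ : HasDerivAt γ c t) (hγt : γ t = x) :
    HasDerivAt (fun s => f (γ s) s) (c • f₁ x t + f₂ x t) t := by
  have hev := eventually_hasDerivAt_of_strip hx ht htt' ht' h₁ h₂
  have hnhds := mem_nhds_halfStrip hx ht htt' ht'
  have hcont : Continuous (ContinuousLinearMap.toSpanSingleton ℝ : Mat2 m → ℝ →L[ℝ] Mat2 m) :=
    (ContinuousLinearMap.toSpanSingletonCLE (𝕜 := ℝ) (E := Mat2 m)).continuous
  -- Continuous partial derivatives near the point give joint differentiability, and the chain rule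
  -- then applies.
  have h := (hasStrictFDerivAt_uncurry_coprod (𝕜 := ℝ) (u := (x, t)) (f := f)
    (f₁ := fun x t => ContinuousLinearMap.toSpanSingleton ℝ (f₁ x t))
    (f₂ := fun x t => ContinuousLinearMap.toSpanSingleton ℝ (f₂ x t))
    (hev.mono fun v hv => hv.1.hasFDerivAt) (hev.mono fun v hv => hv.2.hasFDerivAt)
    (hcont.continuousAt.comp (hc₁.continuousAt hnhds))
    (hcont.continuousAt.comp (hc₂.continuousAt hnhds))).hasFDerivAt
  rw [← hγt] at h
  have h3 := HasFDerivAt.comp_hasDerivAt (f := fun s => (γ s, s)) t h (hγ.prodMk (hasDerivAt_id t))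
  refine h3.congr_deriv ?_
  rw [hγt]
  simp [Function.HasUncurry.uncurry]

variable (hΨ : IsXFundamental tmax u Ψ) (hV : IsTFundamental tmax u V)
  (hsa : IsSelfAdjointOnStrip tmax u) (hG : IsC1OnStrip tmax (G u)) (hF : IsC1OnStrip tmax (F u))
  (hu : SolvesKdV tmax u)

include hΨ in
theorem hasDerivWithinAt_mul_fst (z : ℂ) {x t : ℝ} (hx : 0 ≤ x) (ht : t ∈ timeSet tmax) :
    HasDerivWithinAt (fun y => Ψ y t z * V 0 t z) (G u x t z * (Ψ x t z * V 0 t z)) (Ici 0) x :=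
  ((hΨ.hasDerivWithinAt hx ht z).mul_const (V 0 t z)).congr_deriv (mul_assoc _ _ _)

include hΨ hV hG hF hu in
theorem hasDerivWithinAt_mul_snd (z : ℂ) {x t : ℝ} (hx : 0 ≤ x) (ht : t ∈ timeSet tmax) :
    HasDerivWithinAt (fun s => Ψ x s z * V 0 s z) (F u x t z * (Ψ x t z * V 0 t z))
      (timeSet tmax) t :=
  ((hΨ.hasDerivWithinAt_snd hG hF hu hx ht z).mul ((hV 0 le_rfl z).2 t ht)).congr_deriv
    (by noncomm_ring)

include hΨ hV hG in
theorem continuousOn_mul (z : ℂ) :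
    ContinuousOn (fun p : ℝ × ℝ => Ψ p.1 p.2 z * V 0 p.2 z) (halfStrip tmax) := by
  have h1 : ContinuousOn (fun t => V 0 t z) (timeSet tmax) :=
    fun t ht => ((hV 0 le_rfl z).2 t ht).continuousWithinAt
  exact (hΨ.continuousOn hG z).mul (h1.comp continuousOn_snd fun p hp => hp.2)

include hsa hG hF in
-- The form equals Im z (8|w₂|² + (2c + 16 Re z)|w₁|² - 4w₁*uw₁), where -cG supplies the term with
-- c. The hypothesis on c is what absorbs the remaining terms in |w₁|².
theorem qf_transport_nonneg {C : ℝ}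
    (hC : ∀ x t : ℝ, 0 ≤ x → t ∈ timeSet tmax → ∀ i j, ‖u x t i j‖ ≤ C) {z : ℂ} (hz : 0 < z.im)
    {c : ℝ} (hc : 2 * (C * m) + 8 * |z.re| ≤ c) {x t : ℝ} (hx : 0 ≤ x) (ht : t ∈ timeSet tmax)
    (w : Fin m ⊕ Fin m → ℂ) :
    0 ≤ qf ((F u x t z - (c : ℂ) • G u x t z)ᴴ * sympForm m
      + sympForm m * (F u x t z - (c : ℂ) • G u x t z)) w := by
  have e : (F u x t z - (c : ℂ) • G u x t z)ᴴ * sympForm m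
      + sympForm m * (F u x t z - (c : ℂ) • G u x t z) =
      ((F u x t z)ᴴ * sympForm m + sympForm m * F u x t z)
        + ((-c : ℝ) : ℂ) • ((G u x t z)ᴴ * sympForm m + sympForm m * G u x t z) := by
    rw [conjTranspose_sub, conjTranspose_smul, sub_mul, mul_sub, Matrix.smul_mul, Matrix.mul_smul]
    simp
    module
  rw [e, F_sympForm hsa hG hF hx ht, G_sympForm hsa hx ht]
  simp only [qf_add_left, qf_smul_left]
  have h1 := le_of_abs_le (abs_qf_diag_le (hC x t hx ht) w)
  have h2 := qf_proj₁_nonneg w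
  have h3 := qf_proj₂_nonneg w
  have h4 : 0 ≤ z.im * (8 * qf (proj₂ m) w + (2 * c + 16 * z.re) * qf (proj₁ m) w
      - 4 * qf (fromBlocks (u x t) 0 0 0) w) := by
    refine mul_nonneg hz.le ?_
    have h5 := mul_le_mul_of_nonneg_right hc h2
    have h6 := mul_le_mul_of_nonneg_right (neg_abs_le z.re) h2
    nlinarith
  linarith

include hΨ hV hsa hG hF hu in
/-- Along suitable lines the energy does not decrease. -/
theorem energy_le_energy {C : ℝ}
    (hC : ∀ x t : ℝ, 0 ≤ x → t ∈ timeSet tmax → ∀ i j, ‖u x t i j‖ ≤ C) {z : ℂ} (hz : 0 < z.im)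
    {c : ℝ} (hc0 : 0 < c) (hc : 2 * (C * m) + 8 * |z.re| ≤ c) {x t : ℝ} (hx : 0 ≤ x)
    (ht : t ∈ timeSet tmax) (w : Fin m ⊕ Fin m → ℂ) :
    qf (sympForm m) ((Ψ (x + c * t) 0 z * V 0 0 z) *ᵥ w) ≤
      qf (sympForm m) ((Ψ x t z * V 0 t z) *ᵥ w) := by
  -- The line runs from (x + ct, 0) to (x, t). For 0 < s < t it stays in the interior of the strip,
  -- where two-sided derivatives are available.
  set γ : ℝ → ℝ := fun s => x + c * (t - s)
  have hI := isInitialInterval_timeSet tmax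
  have hγ0 : ∀ s ∈ Icc 0 t, 0 ≤ γ s := fun s hs =>
    add_nonneg hx (mul_nonneg hc0.le (sub_nonneg.2 hs.2))
  have hts : ∀ s ∈ Icc 0 t, s ∈ timeSet tmax := fun s hs => hI.Icc_subset t ht hs
  have hmono : MonotoneOn
      (fun s => qf (sympForm m) ((Ψ (γ s) s z * V 0 s z) *ᵥ w)) (Icc 0 t) := by
    refine monotoneOn_of_hasDerivWithinAt_nonneg (convex_Icc 0 t)
      (f' := fun s => qf ((F u (γ s) s z - (c : ℂ) • G u (γ s) s z)ᴴ * sympForm m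
        + sympForm m * (F u (γ s) s z - (c : ℂ) • G u (γ s) s z))
          ((Ψ (γ s) s z * V 0 s z) *ᵥ w)) ?_ (fun s hs => ?_) fun s hs => ?_
    · have h1 : ContinuousOn (fun s => Ψ (γ s) s z * V 0 s z) (Icc 0 t) :=
        (continuousOn_mul hΨ hV hG z).comp (f := fun s => (γ s, s)) (by fun_prop)
          fun s hs => ⟨hγ0 s hs, hts s hs⟩
      have h2 : Continuous fun X : Mat2 m => X *ᵥ w :=
        continuous_id.matrix_mulVec continuous_const
      exact (continuous_qf _).comp_continuousOn (h2.comp_continuousOn h1)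
    · rw [interior_Icc] at hs
      have hd : HasDerivAt γ (-c) s := by
        exact ((((hasDerivAt_id s).const_sub t).const_mul c).const_add x).congr_deriv (by simp)
      have hpos : 0 < γ s := add_pos_of_nonneg_of_pos hx (mul_pos hc0 (sub_pos.2 hs.2))
      have h1 := hasDerivAt_line_of_strip (f := fun x s => Ψ x s z * V 0 s z) hpos hs.1 hs.2 ht
        (fun x t hx ht => hasDerivWithinAt_mul_fst (V := V) hΨ z hx ht)
        (fun x t hx ht => hasDerivWithinAt_mul_snd hΨ hV hG hF hu z hx ht)
        ((hG.continuousOn z).mul (continuousOn_mul hΨ hV hG z))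
        ((hF.continuousOn z).mul (continuousOn_mul hΨ hV hG z)) hd rfl
      have h2 : HasDerivAt (fun s => Ψ (γ s) s z * V 0 s z)
          ((F u (γ s) s z - (c : ℂ) • G u (γ s) s z) * (Ψ (γ s) s z * V 0 s z)) s := by
        refine h1.congr_deriv ?_
        rw [sub_mul, Matrix.smul_mul, Complex.coe_smul, neg_smul]
        abel
      exact hasDerivWithinAt_qf h2.hasDerivWithinAt _ _
    · have hs' := interior_subset hs
      exact qf_transport_nonneg hsa hG hF hC hz hc (hγ0 s hs') (hts s hs') _
  have h := hmono ⟨le_rfl, ht.1⟩ ⟨ht.1, le_rfl⟩ ht.1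
  simpa [γ] using h

include hΨ hV hsa hG hF in
-- At l = 0 both factors Ψ are the identity, and the symplectic relation turns (V(z̄)*)⁻¹ into
-- -`symp` V(z) `symp`.
theorem T_mul_J_mul_R {t : ℝ} (ht : t ∈ timeSet tmax) (z : ℂ) :
    T m * J m * R Ψ V t z = V 0 t z * T m * J m := by
  have h0 := (isInitialInterval_timeSet tmax).zero_mem ht
  have h1 := hV.symp hsa hG hF le_rfl ht z
  have h2 : ((V 0 t (star z))ᴴ)⁻¹ = -(symp m * V 0 t z * symp m) := by
    refine inv_eq_right_inv ?_
    rw [mul_neg, ← mul_assoc, ← mul_assoc, h1, symp_mul_symp, neg_neg]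
  have h3 : ((T m)ᴴ)⁻¹ = T m := inv_eq_right_inv conjTranspose_T_mul
  have h4 : symp m * T m = Complex.I • (T m * J m) := by
    rw [← mul_smul_comm, ← conjTranspose_T_mul_symp_mul, ← mul_assoc, ← mul_assoc,
      T_mul_conjTranspose, one_mul]
  have h5 : R Ψ V t z = -((T m)ᴴ * symp m * V 0 t z * (symp m * T m)) := by
    rw [R, Rl, (hΨ t ht 0).1, (hΨ 0 h0 0).1, one_mul, h2, h3]
    noncomm_ring
  rw [h5, h4, conjTranspose_T_mul_symp]
  simp only [smul_mul_assoc, mul_smul_comm, smul_smul, Complex.I_mul_I, neg_smul,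
    neg_neg, one_smul]
  calc T m * J m * (J m * (T m)ᴴ * V 0 t z * (T m * J m))
      = T m * (J m * J m) * (T m)ᴴ * V 0 t z * T m * J m := by simp only [mul_assoc]
    _ = V 0 t z * T m * J m := by
      rw [J_mul_J, mul_one, T_mul_conjTranspose, one_mul]

include hΨ hV hsa hG hF in
theorem T_mul_J_mulVec_R_mulVec {t : ℝ} (ht : t ∈ timeSet tmax) (z : ℂ)
    (w : Fin m ⊕ Fin m → ℂ) :
    (T m * J m) *ᵥ (R Ψ V t z *ᵥ w) = V 0 t z *ᵥ ((T m * J m) *ᵥ w) := by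
  rw [mulVec_mulVec, T_mul_J_mul_R hΨ hV hsa hG hF ht, mul_assoc, mulVec_mulVec]

include hΨ hV hsa hG hF hu in
theorem qf_weylForm_R_nonneg (hbdd : IsBoundedOnStrip tmax u) {z : ℂ} (hz : 0 < z.im) {t : ℝ}
    (ht : t ∈ timeSet tmax) {w : Fin m ⊕ Fin m → ℂ}
    (hw : ∀ l, 0 < l → 0 ≤ qf (weylForm Ψ 0 z l) w) {l : ℝ} (hl : 0 < l) :
    0 ≤ qf (weylForm Ψ t z l) (R Ψ V t z *ᵥ w) := by
  obtain ⟨C, hC⟩ := hbdd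
  have h1 := energy_le_energy hΨ hV hsa hG hF hu hC hz
    -- The absolute value and the added 1 make c positive, since the sign of C is not known.
    (c := |2 * (C * m)| + 8 * |z.re| + 1) (by positivity)
    (by linarith [le_abs_self (2 * (C * m))]) hl.le ht ((T m * J m) *ᵥ w)
  have h2 : 0 < l + (|2 * (C * m)| + 8 * |z.re| + 1) * t := by
    have := ht.1
    positivity
  have h3 := hw _ h2
  rw [qf_weylForm] at h3 ⊢
  rw [(hV 0 le_rfl z).1, mul_one] at h1
  rw [T_mul_J_mulVec_R_mulVec hΨ hV hsa hG hF ht, mulVec_mulVec]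
  exact h3.trans h1

include hΨ hV hsa hG hF in
theorem eq_zero_of_R_mulVec {z : ℂ} {t : ℝ} (ht : t ∈ timeSet tmax) {w : Fin m ⊕ Fin m → ℂ}
    (hw : R Ψ V t z *ᵥ w = 0) : w = 0 := by
  have h : (T m * J m) *ᵥ (R Ψ V t z *ᵥ w) = 0 := by rw [hw, mulVec_zero]
  rw [T_mul_J_mulVec_R_mulVec hΨ hV hsa hG hF ht] at h
  refine mulVec_eq_zero_of_mul_eq_one (Y := J m * (T m)ᴴ) (X := T m * J m) ?_
    (mulVec_eq_zero_of_mul_eq_one (mul_eq_one_of_symp (hV.symp hsa hG hF le_rfl ht z)) h)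
  rw [mul_assoc, ← mul_assoc (T m)ᴴ, conjTranspose_T_mul, one_mul, J_mul_J]

end Evolution

end MatrixKdV

/-! ### Evolution of the Weyl function -/

theorem proposition3p1 (m : ℕ) (tmax : EReal) (u : ℝ → ℝ → MatrixKdV.Mat m)
    (hsa : MatrixKdV.IsSelfAdjointOnStrip tmax u)
    (hbdd : MatrixKdV.IsBoundedOnStrip tmax u)
    (hG : MatrixKdV.IsC1OnStrip tmax (MatrixKdV.G u))
    (hF : MatrixKdV.IsC1OnStrip tmax (MatrixKdV.F u))
    (hu : MatrixKdV.SolvesKdV tmax u) :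
    (∃ Ψ V : ℝ → ℝ → ℂ → MatrixKdV.Mat2 m,
      MatrixKdV.IsXFundamental tmax u Ψ ∧ MatrixKdV.IsTFundamental tmax u V) ∧
    ∀ Ψ V : ℝ → ℝ → ℂ → MatrixKdV.Mat2 m,
      MatrixKdV.IsXFundamental tmax u Ψ → MatrixKdV.IsTFundamental tmax u V →
      (∀ t ∈ MatrixKdV.timeSet tmax, ∃ Mt : ℂ → MatrixKdV.Mat m,
        MatrixKdV.IsWeylFunction (fun x => MatrixKdV.hamiltonian Ψ x t) Mt) ∧
      ∀ M : ℝ → ℂ → MatrixKdV.Mat m,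
        (∀ t ∈ MatrixKdV.timeSet tmax,
          MatrixKdV.IsWeylFunction (fun x => MatrixKdV.hamiltonian Ψ x t) (M t)) →
        ∀ t ∈ MatrixKdV.timeSet tmax, ∀ z : ℂ, 0 < z.im →
          IsUnit ((-Complex.I) • ((MatrixKdV.R Ψ V t z).toBlocks₂₁ * M 0 z)
            + (MatrixKdV.R Ψ V t z).toBlocks₂₂) ∧
          M t z = Complex.I •
            (((-Complex.I) • ((MatrixKdV.R Ψ V t z).toBlocks₁₁ * M 0 z)
                + (MatrixKdV.R Ψ V t z).toBlocks₁₂) *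
              ((-Complex.I) • ((MatrixKdV.R Ψ V t z).toBlocks₂₁ * M 0 z)
                + (MatrixKdV.R Ψ V t z).toBlocks₂₂)⁻¹) := by
  refine ⟨?_, fun Ψ V hΨ hV => ⟨fun t ht => MatrixKdV.exists_isWeylFunction hΨ hsa ht hbdd,
    fun M hM t ht z hz => ?_⟩⟩
  · obtain ⟨Ψ, hΨ⟩ := MatrixKdV.exists_isXFundamental hG
    obtain ⟨V, hV⟩ := MatrixKdV.exists_isTFundamental hF
    exact ⟨Ψ, V, hΨ, hV⟩
  have h0 := (MatrixKdV.isInitialInterval_timeSet tmax).zero_mem ht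
  have hN₀ : ∀ l : ℝ, 0 < l → _ := fun l hl =>
    MatrixKdV.IsWeylFunction.neg_I_smul_mem_weylDisk hΨ hsa h0 hz hbdd (hM 0 h0) hl
  have hN : ∀ l : ℝ, 0 < l → _ := fun l hl =>
    MatrixKdV.IsWeylFunction.neg_I_smul_mem_weylDisk hΨ hsa ht hz hbdd (hM t ht) hl
  have hE := MatrixKdV.isWeylFamily_weylForm hΨ hsa ht hz hbdd
  set A := (-Complex.I) • ((MatrixKdV.R Ψ V t z).toBlocks₁₁ * M 0 z)
    + (MatrixKdV.R Ψ V t z).toBlocks₁₂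
  set D := (-Complex.I) • ((MatrixKdV.R Ψ V t z).toBlocks₂₁ * M 0 z)
    + (MatrixKdV.R Ψ V t z).toBlocks₂₂
  -- The pair (A, D) is the image under R of the graph of -iM(0,z), that is, of the pair (-iM(0,z),
  -- I).
  have hAD : ∀ v, (Sum.elim (A.mulVec v) (D.mulVec v) : Fin m ⊕ Fin m → ℂ) =
      (MatrixKdV.R Ψ V t z).mulVec (MatrixKdV.graphVec ((-Complex.I) • M 0 z) v) := fun v => by
    have h := MatrixKdV.mulVec_elim (MatrixKdV.R Ψ V t z) ((-Complex.I) • M 0 z) 1 v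
    rw [Matrix.one_mulVec] at h
    rw [MatrixKdV.graphVec, h, MatrixKdV.lftDen, mul_one, mul_one, Matrix.mul_smul,
      Matrix.mul_smul]
  have hpos : ∀ l : ℝ, 0 < l → ∀ v, 0 ≤ MatrixKdV.qf (MatrixKdV.weylForm Ψ t z l)
      (Sum.elim (A.mulVec v) (D.mulVec v)) := fun l hl v => by
    rw [hAD]
    exact MatrixKdV.qf_weylForm_R_nonneg hΨ hV hsa hG hF hu hbdd hz ht
      (fun l hl => hN₀ l hl v) hl
  have hD : IsUnit D := by
    refine MatrixKdV.isUnit_of_qf_nonneg (hE.lt 1 one_pos) (hpos 1 one_pos) fun v hv => ?_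
    rw [hAD] at hv
    have h1 := MatrixKdV.eq_zero_of_R_mulVec hΨ hV hsa hG hF ht hv
    exact funext fun i => congrFun h1 (Sum.inr i)
  refine ⟨hD, ?_⟩
  -- Both -iM(t,z) and AD⁻¹ lie in every Weyl disk at time t, hence they coincide.
  have h := hE.eq_of_mem_weylDisk hN fun l hl => MatrixKdV.mul_inv_mem_weylDisk hD (hpos l hl)
  rw [← h, smul_smul]
  simp
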